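/- All systems are finite-dimensional and $\log$ is to base $2$. For a density operator $\rho$ with eigenvalues $(r_j)$ (listed with multiplicity) and $0\le\epsilon<1$ put $$\Delta_\epsilon(\rho)=\log\min\Bigl\{|J|\,\max_{j\in J}r_j \;:\; \sum_{j\in J}r_j\ge 1-\epsilon\Bigr\},$$ the minimum being over sets $J$ of eigenvalue indices; in particular $\Delta_0(\rho)=\log\operatorname{rank}\rho+\log\|\rho\|_\infty$. Let $F(\sigma,\omega)=\bigl(\operatorname{Tr}\sqrt{\sigma^{1/2}\omega\sigma^{1/2}}\bigr)^2$ denote the Uhlmann fidelity. A state transformation protocol consists of finitely many rounds. In round $i$ one of the two parties, Alice or Bob, applies a local operation (a unitary, possibly using local ancillas in a fixed pure state, i.e. an isometry) to the system in his or her possession, which separates it into a residual system and a $d_i$-dimensional quantum system, and sends the latter to the other party. After the last round both parties may apply a further local operation and then discard (trace out) part of their systems. The communication cost of the protocol is $C=\sum_i\log d_i$ qubits. (i) For every density operator $\rho$, $\Delta_0\bigl(\rho\otimes\tfrac12\mathbb 1\bigr)=\Delta_0(\rho)$, where $\tfrac12\mathbb 1$ is the maximally mixed state of a qubit. (ii)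 Let $|\phi_{AB}\rangle$ and $|\psi_{AB}\rangle$ be bipartite pure states (possibly of systems of different dimensions), let $\epsilon\ge 0$ be such that $\delta:=\sqrt[8]{4\epsilon}<1$, and let $k\ge 0$ be any integer. Suppose that a protocol of communication cost $C$, started in the state $|\phi_{AB}\rangle$ supplemented by $k$ EPR pairs $\tfrac1{\sqrt2}(|00\rangle+|11\rangle)$ shared between Alice and Bob, outputs a (possibly mixed) state whose fidelity to $|\psi_{AB}\rangle$ is at least $1-\epsilon$. Then $$2C\;\ge\;\Delta_\delta\bigl(\operatorname{Tr}_B|\psi\rangle\langle\psi|\bigr)-\Delta_0\bigl(\operatorname{Tr}_B|\phi\rangle\langle\phi|\bigr)+2\log(1-\delta),$$ so the bound does not depend on the number $k$ of EPR pairs. -/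

import Mathlib

/-! Finite-dimensional quantum systems are given by finite index types: the system with index type
`A` has Hilbert space `ℂ^A`, the joint system of `A` and `B` has `ℂ^(A × B) = ℂ^A ⊗ ℂ^B`.
All logarithms are to base 2. -/

namespace EntTransform

open scoped Matrix Kronecker ComplexOrder

/-- A density operator: positive semidefinite of trace one. -/
structure DensityOperator (n : Type) [Fintype n] where
  mat : Matrix n n ℂ
  posSemidef : mat.PosSemidef
  trace_eq_one : mat.trace = 1

/-- A bipartite pure state: a unit vector of `ℂ^A ⊗ ℂ^B`. -/
structure PureState (A B : Type) [Fintype A] [Fintype B] where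
  vec : A × B → ℂ
  normalized : ∑ p, ‖vec p‖ ^ 2 = 1

/-- The rank one operator `|φ⟩⟨φ|`. -/
def ketbra {n : Type} (φ : n → ℂ) : Matrix n n ℂ := Matrix.vecMulVec φ (star φ)

/-- The partial trace over the second factor. -/
def trRight {A B : Type} [Fintype B] (M : Matrix (A × B) (A × B) ℂ) : Matrix A A ℂ :=
  Matrix.of fun a a' => ∑ b, M (a, b) (a', b)

theorem posSemidef_trRight_ketbra {A B : Type} [Fintype A] [Fintype B] (φ : A × B → ℂ) :
    (trRight (ketbra φ)).PosSemidef := by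
  have h : trRight (ketbra φ) =
      ∑ b : B, Matrix.vecMulVec (fun a => φ (a, b)) (star fun a => φ (a, b)) := by
    ext a a'
    simp [trRight, ketbra, Matrix.vecMulVec_apply, Matrix.sum_apply]
  rw [h]
  exact Matrix.posSemidef_sum _ fun b _ => Matrix.posSemidef_vecMulVec_self_star _

theorem trace_trRight_ketbra {A B : Type} [Fintype A] [Fintype B] (φ : PureState A B) :
    (trRight (ketbra φ.vec)).trace = 1 := by
  have h : (trRight (ketbra φ.vec)).trace = ((∑ p, ‖φ.vec p‖ ^ 2 : ℝ) : ℂ) := by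
    simp [trRight, ketbra, Matrix.vecMulVec_apply, Matrix.trace, Fintype.sum_prod_type,
      Complex.mul_conj, Complex.normSq_eq_norm_sq]
  rw [h, φ.normalized, Complex.ofReal_one]

/-- Alice's reduced state `Tr_B |φ⟩⟨φ|`. -/
def PureState.reduced {A B : Type} [Fintype A] [Fintype B] (φ : PureState A B) :
    DensityOperator A where
  mat := trRight (ketbra φ.vec)
  posSemidef := posSemidef_trRight_ketbra φ.vec
  trace_eq_one := trace_trRight_ketbra φ

/-- The tensor product `ρ ⊗ σ` of density operators. -/
def DensityOperator.tensor {m n : Type} [Fintype m] [Fintype n]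
    (ρ : DensityOperator m) (σ : DensityOperator n) : DensityOperator (m × n) where
  mat := ρ.mat ⊗ₖ σ.mat
  posSemidef := ρ.posSemidef.kronecker σ.posSemidef
  trace_eq_one := by rw [Matrix.trace_kronecker, ρ.trace_eq_one, σ.trace_eq_one, one_mul]

/-- The maximally mixed qubit state `½ 𝟙`. -/
noncomputable def mixedQubit : DensityOperator (Fin 2) where
  mat := (1 / 2 : ℂ) • (1 : Matrix (Fin 2) (Fin 2) ℂ)
  posSemidef := Matrix.PosSemidef.one.smul (by
    rw [Complex.le_def]; norm_num : (0 : ℂ) ≤ 1 / 2)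
  trace_eq_one := by simp [Matrix.trace_smul]

/-- The eigenvalues of a density operator, with multiplicity, indexed by `n`. -/
noncomputable def DensityOperator.eig {n : Type} [Fintype n] [DecidableEq n]
    (ρ : DensityOperator n) : n → ℝ :=
  ρ.posSemidef.isHermitian.eigenvalues

/-- `Δ_ε(ρ) = log min { |J| · max_{j ∈ J} r_j : ∑_{j ∈ J} r_j ≥ 1 - ε }`, the minimum being over
sets `J` of indices of the eigenvalues `r_j` of `ρ`. For `0 ≤ ε < 1` only nonempty `J` can satisfy
the constraint, and the set of values is finite, nonempty and positive, so `sInf` is the minimum. -/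
noncomputable def Delta {n : Type} [Fintype n] [DecidableEq n] (ε : ℝ)
    (ρ : DensityOperator n) : ℝ :=
  Real.logb 2 (sInf {x : ℝ | ∃ (J : Finset n) (hJ : J.Nonempty),
    1 - ε ≤ ∑ j ∈ J, ρ.eig j ∧ x = (J.card : ℝ) * J.sup' hJ ρ.eig})

open scoped MatrixOrder in
/-- The Uhlmann fidelity `F(σ, ω) = (Tr √(σ^{1/2} ω σ^{1/2}))²`. -/
noncomputable def fidelity {n : Type} [Fintype n] [DecidableEq n] (σ ω : Matrix n n ℂ) : ℝ :=
  (CFC.sqrt (CFC.sqrt σ * ω * CFC.sqrt σ)).trace.re ^ 2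

/-- The EPR pair `(|00⟩ + |11⟩)/√2`, one qubit with each party. -/
noncomputable def epr : Fin 2 × Fin 2 → ℂ :=
  fun p => if p.1 = p.2 then ((1 / Real.sqrt 2 : ℝ) : ℂ) else 0

/-- The state `φ` together with `k` EPR pairs; each party holds `k` additional qubits. -/
noncomputable def withEPR {A B : Type} (φ : A × B → ℂ) (k : ℕ) :
    (A × (Fin k → Fin 2)) × (B × (Fin k → Fin 2)) → ℂ :=
  fun p => φ (p.1.1, p.2.1) * ∏ i, epr (p.1.2 i, p.2.2 i)

/-- `(U ⊗ 𝟙) φ`, with `U` acting on Alice's side. -/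
def actA {A A' B : Type} [Fintype A] (U : Matrix A' A ℂ) (φ : A × B → ℂ) : A' × B → ℂ :=
  fun p => ∑ a, U p.1 a * φ (a, p.2)

/-- `(𝟙 ⊗ V) φ`, with `V` acting on Bob's side. -/
def actB {A B B' : Type} [Fintype B] (V : Matrix B' B ℂ) (φ : A × B → ℂ) : A × B' → ℂ :=
  fun p => ∑ b, V p.2 b * φ (p.1, b)

/-- The joint state after Alice applies `U` and hands the second factor of her system to Bob. -/
def afterSendA {A A' B : Type} [Fintype A] {d : ℕ} (U : Matrix (A' × Fin d) A ℂ)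
    (φ : A × B → ℂ) : A' × (Fin d × B) → ℂ :=
  fun p => actA U φ ((p.1, p.2.1), p.2.2)

/-- The joint state after Bob applies `V` and hands the first factor of his system to Alice. -/
def afterSendB {A B B' : Type} [Fintype B] {d : ℕ} (V : Matrix (Fin d × B') B ℂ)
    (φ : A × B → ℂ) : (A × Fin d) × B' → ℂ :=
  fun p => actB V φ (p.1.1, (p.1.2, p.2))

/-- The joint state after the last local operations, before `A'` and `B'` are discarded. -/
def finalVec {S T A B A' B' : Type} [Fintype A] [Fintype B] (U : Matrix (S × A') A ℂ)
    (V : Matrix (T × B') B ℂ) (φ : A × B → ℂ) : (S × T) × (A' × B') → ℂ :=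
  fun p => actA U (actB V φ) ((p.1.1, p.2.1), (p.1.2, p.2.2))

/-- State transformation protocols with quantum communication. The indices `A`, `B` are the systems
currently held by Alice and Bob, the parameters `S`, `T` their output systems. A local operation is
an isometry, i.e. a unitary acting on the system and local ancillas in a fixed pure state.
* `sendA d U _ rest`: Alice applies `U`, which separates her system into a residual system `A'` and
  a `d`-dimensional system that she sends to Bob; then `rest` is carried out.
* `sendB d V _ rest`: the same with the roles exchanged.
* `finish U V _ _`: there is no more communication; both apply local operations separating their
  systems into the outputs `S`, `T` and the subsystems `A'`, `B'`, which they discard. -/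
inductive Protocol (S T : Type) [Fintype S] [Fintype T] :
    (A B : Type) → [Fintype A] → [DecidableEq A] → [Fintype B] → [DecidableEq B] → Type 1
  | finish {A B : Type} [Fintype A] [DecidableEq A] [Fintype B] [DecidableEq B]
      {A' B' : Type} [Fintype A'] [DecidableEq A'] [Fintype B'] [DecidableEq B']
      (U : Matrix (S × A') A ℂ) (V : Matrix (T × B') B ℂ)
      (hU : Uᴴ * U = 1) (hV : Vᴴ * V = 1) : Protocol S T A B
  | sendA {A B : Type} [Fintype A] [DecidableEq A] [Fintype B] [DecidableEq B]
      {A' : Type} [Fintype A'] [DecidableEq A'] (d : ℕ)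
      (U : Matrix (A' × Fin d) A ℂ) (hU : Uᴴ * U = 1)
      (rest : Protocol S T A' (Fin d × B)) : Protocol S T A B
  | sendB {A B : Type} [Fintype A] [DecidableEq A] [Fintype B] [DecidableEq B]
      {B' : Type} [Fintype B'] [DecidableEq B'] (d : ℕ)
      (V : Matrix (Fin d × B') B ℂ) (hV : Vᴴ * V = 1)
      (rest : Protocol S T (A × Fin d) B') : Protocol S T A B

/-- The total communication `C = ∑ log d_i` of a protocol, in qubits. -/
noncomputable def Protocol.cost {S T : Type} [Fintype S] [Fintype T] : {A B : Type} →
    [Fintype A] → [DecidableEq A] → [Fintype B] → [DecidableEq B] → Protocol S T A B → ℝ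
  | _, _, _, _, _, _, @finish _ _ _ _ _ _ _ _ _ _ _ _ _ _ _ _ _ _ _ _ => 0
  | _, _, _, _, _, _, @sendA _ _ _ _ _ _ _ _ _ _ _ _ _ d _ _ rest => Real.logb 2 d + rest.cost
  | _, _, _, _, _, _, @sendB _ _ _ _ _ _ _ _ _ _ _ _ _ d _ _ rest => Real.logb 2 d + rest.cost

/-- The joint output state on `S × T` of a protocol started in the pure state `φ`. -/
noncomputable def Protocol.output {S T : Type} [Fintype S] [Fintype T] : {A B : Type} →
    [Fintype A] → [DecidableEq A] → [Fintype B] → [DecidableEq B] →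
    Protocol S T A B → (A × B → ℂ) → Matrix (S × T) (S × T) ℂ
  | _, _, _, _, _, _, @finish _ _ _ _ _ _ _ _ _ _ _ _ _ _ _ _ U V _ _, φ =>
      trRight (ketbra (finalVec U V φ))
  | _, _, _, _, _, _, @sendA _ _ _ _ _ _ _ _ _ _ _ _ _ _ U _ rest, φ =>
      rest.output (afterSendA U φ)
  | _, _, _, _, _, _, @sendB _ _ _ _ _ _ _ _ _ _ _ _ _ _ V _ rest, φ =>
      rest.output (afterSendB V φ)

end EntTransform

/-! `Delta 0` of a reduced pure state is the log of (Schmidt rank) × (largest squared Schmidt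
coefficient). Local isometries do not increase either factor, and sending a `d`-dimensional system
multiplies each by at most `d`, so a round raises the log by at most `2 log d`. An EPR pair doubles
the rank and halves the coefficients, so `k` cancels. Hence the purified output `Φ` has rank at most
`r` and coefficients at most `l` with `log (r l) = Delta 0 φ + 2C` (`HasSpread.withEPR`,
`Protocol.exists_purification`).

By Uhlmann (`exists_pureState_overlap_eq`), `Φ` has squared overlap at least `1 - ε` with `ψ ⊗ χ`
for some pure `χ` on the discarded systems. The Schmidt weights of `ψ ⊗ χ` are products `p i * q j`.
Some `r` of them carry weight at least `1 - ε` (a Ky Fan argument), and a Hellinger distance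
estimate shows that little weight sits on those above `l / (1 - δ)`. What remains is a set `G` of at
most `r` pairs, each of weight at most `l / (1 - δ)`, with total weight at least `1 - δ ^ 2`
(`exists_heavy_finset`). Averaging over `j` gives a section `J` of `G` with `p`-weight at least `1 -
δ` and `|J| max p ≤ r l / (1 - δ) ^ 2` (`exists_heavy_section`). This set bounds `Delta δ ψ`. -/

namespace EntTransform

open scoped Matrix Kronecker ComplexOrder

/-! ### Inequalities for finite probability distributions -/

/-- A fractional selection of total weight `R` collects at most as much as some `R` elements. -/
theorem exists_finset_card_le_sum_mul_le {K : Type} [Fintype K] [DecidableEq K] (w t : K → ℝ)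
    (R : ℕ) (hw : ∀ k, 0 ≤ w k) (ht0 : ∀ k, 0 ≤ t k) (ht1 : ∀ k, t k ≤ 1)
    (ht : ∑ k, t k ≤ R) : ∃ T : Finset K, T.card ≤ R ∧ ∑ k, w k * t k ≤ ∑ k ∈ T, w k := by
  by_cases hK : Fintype.card K ≤ R
  · exact ⟨Finset.univ, hK, Finset.sum_le_sum fun k _ => mul_le_of_le_one_right (hw k) (ht1 k)⟩
  rcases Nat.eq_zero_or_pos R with rfl | hR
  · refine ⟨∅, le_rfl, ?_⟩
    have h0 : ∀ k, t k = 0 := fun k => le_antisymm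
      ((Finset.single_le_sum (fun i _ => ht0 i) (Finset.mem_univ k)).trans (by simpa using ht))
      (ht0 k)
    simp [h0]
  have hne : (Finset.powersetCard R (Finset.univ : Finset K)).Nonempty :=
    Finset.powersetCard_nonempty.2 (by rw [Finset.card_univ]; omega)
  obtain ⟨T, hT, hmax⟩ := Finset.exists_max_image _ (fun T => ∑ k ∈ T, w k) hne
  have hTc : T.card = R := (Finset.mem_powersetCard.1 hT).2
  have hTn : T.Nonempty := Finset.card_pos.1 (hTc ▸ hR)
  obtain ⟨m, hm, hmin⟩ := Finset.exists_min_image T w hTn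
  refine ⟨T, hTc.le, ?_⟩
  have hout : ∀ k ∉ T, w k ≤ w m := by
    intro k hk
    have hk' : k ∉ T.erase m := fun h => hk (Finset.mem_of_mem_erase h)
    have h := hmax (insert k (T.erase m)) (Finset.mem_powersetCard.2 ⟨Finset.subset_univ _, by
      rw [Finset.card_insert_of_notMem hk', Finset.card_erase_of_mem hm]; omega⟩)
    simp only [Finset.sum_insert hk'] at h
    have := Finset.add_sum_erase T w hm
    linarith
  -- `w m` is a threshold: weights in `T` are at least `w m`, those outside at most `w m`. Summing
  -- leaves `w m * (∑ t - R) ≤ 0`.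
  have key : ∀ k, w k * t k - (if k ∈ T then w k else 0)
      ≤ w m * (t k - if k ∈ T then 1 else 0) := by
    intro k
    by_cases hk : k ∈ T
    · simp only [hk, if_true]
      nlinarith [hmin k hk, ht1 k]
    · simp only [hk, if_false, sub_zero]
      exact mul_le_mul_of_nonneg_right (hout k hk) (ht0 k)
  have hs := Finset.sum_le_sum fun k (_ : k ∈ Finset.univ) => key k
  rw [← Finset.mul_sum, Finset.sum_sub_distrib, Finset.sum_sub_distrib] at hs
  simp only [Finset.sum_ite_mem, Finset.univ_inter, Finset.sum_const, hTc, nsmul_eq_mul,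
    mul_one] at hs
  nlinarith [hw m]

/-- If `√m` and `√w` nearly overlap and `m ≤ L`, little of `w` lies far above `L`. -/
theorem sum_filter_mul_le {K : Type} [Fintype K] (m w : K → ℝ) (L s f : ℝ)
    (hm : ∀ k, 0 ≤ m k) (hw : ∀ k, 0 ≤ w k) (hm1 : ∑ k, m k = 1) (hw1 : ∑ k, w k = 1)
    (hL : ∀ k, m k ≤ L) (hs0 : 0 ≤ s) (hs1 : s ≤ 1) (hf : f ≤ ∑ k, √(m k) * √(w k)) :
    (∑ k with L < s ^ 2 * w k, w k) * (1 - s) ^ 2 ≤ 2 * (1 - f) := by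
  have h1 : ∑ k, (√(w k) - √(m k)) ^ 2 = 2 - 2 * ∑ k, √(m k) * √(w k) := by
    have : ∀ k, (√(w k) - √(m k)) ^ 2 = w k + m k - 2 * (√(m k) * √(w k)) := fun k => by
      linear_combination Real.sq_sqrt (hw k) + Real.sq_sqrt (hm k)
    simp only [this, Finset.sum_sub_distrib, Finset.sum_add_distrib, ← Finset.mul_sum, hm1, hw1]
    ring
  have h2 : (∑ k with L < s ^ 2 * w k, w k) * (1 - s) ^ 2 ≤ ∑ k, (√(w k) - √(m k)) ^ 2 := by
    rw [Finset.sum_mul]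
    refine (Finset.sum_le_sum fun k hk => ?_).trans
      (Finset.sum_le_univ_sum_of_nonneg fun k => sq_nonneg _)
    have hk' := (Finset.mem_filter.1 hk).2
    -- Each filtered index thus contributes at least `(1 - s) ^ 2 * w k` to the squared Hellinger
    -- distance computed in `h1`.
    have hle : √(m k) ≤ s * √(w k) := by
      rw [← Real.sqrt_sq hs0, ← Real.sqrt_mul (sq_nonneg s)]
      exact Real.sqrt_le_sqrt ((hL k).trans hk'.le)
    have hsw := Real.sqrt_nonneg (w k)
    calc w k * (1 - s) ^ 2 = ((1 - s) * √(w k)) ^ 2 := by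
          rw [mul_pow, Real.sq_sqrt (hw k)]; ring
      _ ≤ _ := pow_le_pow_left₀ (mul_nonneg (by linarith) hsw) (by linarith) 2
  linarith

/-- The Hellinger bound with `s = √(1 - δ)`. The target `δ ^ 2 - ε` is what may still be lost from a
set of weight `1 - ε` if `1 - δ ^ 2` is to remain. -/
theorem sum_filter_le_sq_sub {K : Type} [Fintype K] (m w : K → ℝ) (L ε δ : ℝ)
    (hm : ∀ k, 0 ≤ m k) (hw : ∀ k, 0 ≤ w k) (hm1 : ∑ k, m k = 1) (hw1 : ∑ k, w k = 1)
    (hL : ∀ k, m k ≤ L) (hδ0 : 0 ≤ δ) (hδ1 : δ < 1) (hε : 4 * ε = δ ^ 8)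
    (hf : 1 - ε ≤ ∑ k, √(m k) * √(w k)) :
    ∑ k with L < (1 - δ) * w k, w k ≤ δ ^ 2 - ε := by
  have hsq : √(1 - δ) ^ 2 = 1 - δ := Real.sq_sqrt (by linarith)
  have hs0 : 0 ≤ √(1 - δ) := Real.sqrt_nonneg _
  have hs1 : √(1 - δ) ≤ 1 := Real.sqrt_le_one.2 (by linarith)
  have h := sum_filter_mul_le m w L (√(1 - δ)) (1 - ε) hm hw hm1 hw1 hL hs0 hs1 hf
  rw [hsq] at h
  -- For `δ = 0` the estimate cannot be divided by `δ ^ 2`; there the Hellinger distance vanishes,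
  -- so `w = m ≤ L` and the filter is empty.
  rcases hδ0.eq_or_lt with rfl | hδ
  · have hε0 : ε = 0 := by linarith
    subst hε0
    have hz : ∑ k, (√(w k) - √(m k)) ^ 2 ≤ 0 := by
      have : ∀ k, (√(w k) - √(m k)) ^ 2 = w k + m k - 2 * (√(m k) * √(w k)) := fun k => by
        linear_combination Real.sq_sqrt (hw k) + Real.sq_sqrt (hm k)
      simp only [this, Finset.sum_sub_distrib, Finset.sum_add_distrib, ← Finset.mul_sum, hm1, hw1]
      linarith
    have heq : ∀ k, w k = m k := fun k => by
      have h1 : (√(w k) - √(m k)) ^ 2 = 0 := le_antisymm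
        ((Finset.single_le_sum (fun i _ => sq_nonneg (√(w i) - √(m i)))
          (Finset.mem_univ k)).trans hz) (sq_nonneg _)
      exact (Real.sqrt_inj (hw k) (hm k)).1 (by nlinarith [pow_eq_zero_iff two_ne_zero |>.1 h1])
    have : ∀ k, ¬ L < (1 - 0) * w k := fun k => by
      rw [heq k]; linarith [hL k]
    rw [Finset.filter_false_of_mem fun k _ => this k]
    simp
  · set W := ∑ k with L < (1 - δ) * w k, w k
    set s := √(1 - δ)
    have hδs : δ = (1 - s) * (1 + s) := by linear_combination hsq
    have hδ2 : 0 < δ ^ 2 := by positivity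
    have hWδ : W * δ ^ 2 ≤ 2 * ε * (1 + s) ^ 2 := by
      calc W * δ ^ 2 = W * (1 - s) ^ 2 * (1 + s) ^ 2 := by rw [hδs]; ring
        _ ≤ 2 * (1 - (1 - ε)) * (1 + s) ^ 2 := mul_le_mul_of_nonneg_right h (sq_nonneg _)
        _ = _ := by ring
    have hA0 : 0 ≤ δ * (1 + s) := by positivity
    -- The maximum of `(1 - s) * (1 + s) ^ 2` on `[0, 1]` is `32 / 27`, attained at `s = 1 / 3`.
    have hA : δ * (1 + s) ≤ 6 / 5 := by
      rw [hδs]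
      nlinarith [sq_nonneg (s - 1 / 3), mul_nonneg hs0 (sq_nonneg (s - 1 / 3))]
    have hA2 : (δ * (1 + s)) ^ 2 ≤ 36 / 25 := by nlinarith
    have hd6 : δ ^ 6 ≤ 1 := pow_le_one₀ hδ.le hδ1.le
    have hd2 : δ ^ 2 ≤ 1 := pow_le_one₀ hδ.le hδ1.le
    have hd4 : 0 < δ ^ 4 := by positivity
    have hfin : 2 * ε * (1 + s) ^ 2 ≤ (δ ^ 2 - ε) * δ ^ 2 := by
      have e1 : 2 * ε * (1 + s) ^ 2 = δ ^ 4 * (δ ^ 2 * (δ * (1 + s)) ^ 2 / 2) := by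
        linear_combination (1 + s) ^ 2 / 2 * hε
      have e2 : (δ ^ 2 - ε) * δ ^ 2 = δ ^ 4 * (1 - δ ^ 6 / 4) := by
        linear_combination - δ ^ 2 / 4 * hε
      rw [e1, e2]
      refine mul_le_mul_of_nonneg_left ?_ hd4.le
      nlinarith [mul_le_mul hd2 hA2 (sq_nonneg _) zero_le_one]
    exact le_of_mul_le_mul_right (hWδ.trans hfin) hδ2

/-- From a set of pairs `G` heavy for a product distribution to a heavy set for the first factor. -/
theorem exists_heavy_section {I K : Type} [Fintype I] [DecidableEq I] [Fintype K] [DecidableEq K]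
    (p : I → ℝ) (q : K → ℝ) (hp : ∀ i, 0 ≤ p i) (hq : ∀ j, 0 ≤ q j) (hp1 : ∑ i, p i = 1)
    (hq1 : ∑ j, q j = 1) (G : Finset (I × K)) (R : ℕ) (L δ : ℝ) (hδ0 : 0 ≤ δ) (hδ1 : δ < 1)
    (hG : G.card ≤ R) (hGL : ∀ x ∈ G, (1 - δ) * (p x.1 * q x.2) ≤ L)
    (hGw : 1 - δ ^ 2 ≤ ∑ x ∈ G, p x.1 * q x.2) :
    ∃ (J : Finset I) (hJ : J.Nonempty), 1 - δ ≤ ∑ i ∈ J, p i ∧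
      (J.card : ℝ) * J.sup' hJ p ≤ R * L / (1 - δ) ^ 2 := by
  have hδ' : 0 < 1 - δ := by linarith
  set S : K → Finset I := fun j => Finset.univ.filter fun i => (i, j) ∈ G with hS
  have hcard : ∑ j, ((S j).card : ℝ) ≤ R := by
    have : ∑ j, (S j).card = G.card := by
      simp only [hS, Finset.card_filter]
      rw [Finset.sum_comm, ← Fintype.sum_prod_type (f := fun x : I × K => if x ∈ G then 1 else 0)]
      simp
    exact_mod_cast this.le.trans hG
  have hmass : ∑ j, q j * ∑ i ∈ S j, p i = ∑ x ∈ G, p x.1 * q x.2 := by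
    simp only [hS, Finset.sum_filter, Finset.mul_sum]
    rw [Finset.sum_comm, ← Fintype.sum_prod_type
      (f := fun x : I × K => q x.2 * if (x.1, x.2) ∈ G then p x.1 else 0)]
    have : ∑ x ∈ G, p x.1 * q x.2 = ∑ x, if x ∈ G then p x.1 * q x.2 else 0 := by simp
    rw [this]
    exact Finset.sum_congr rfl fun x _ => by split_ifs <;> ring
  have hle1 : ∀ j, ∑ i ∈ S j, p i ≤ 1 := fun j =>
    hp1 ▸ Finset.sum_le_univ_sum_of_nonneg fun i => hp i
  have hdef : ∑ j, q j * (1 - ∑ i ∈ S j, p i) ≤ δ ^ 2 := by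
    simp only [mul_sub, mul_one, Finset.sum_sub_distrib, hq1, hmass]
    linarith
  have hRpos : (0 : ℝ) < R := by
    have : G.Nonempty := by
      rw [Finset.nonempty_iff_ne_empty]
      rintro rfl
      simp only [Finset.sum_empty] at hGw
      nlinarith
    exact_mod_cast (Finset.card_pos.2 this).trans_le hG
  obtain ⟨j0, hj0⟩ : ∃ j, 0 < q j := by
    by_contra! h
    linarith [Finset.sum_nonpos fun j (_ : j ∈ Finset.univ) => h j]
  -- If no such `j` exists, each `j` with `q j > 0` has either a section that is too large or a
  -- defect above `δ`. Weighting the two alternatives and summing gives `δ R < δ (1 - δ) R + R δ ^ 2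
  -- = δ R`. For `δ = 0` this is vacuous, but then all defects vanish and the cardinalities alone
  -- contradict `hcard`.
  obtain ⟨j, hqj, hpj, hcj⟩ : ∃ j, 0 < q j ∧ 1 - δ ≤ ∑ i ∈ S j, p i ∧
      (S j).card * (1 - δ) ≤ R * q j := by
    by_contra! hcon
    rcases hδ0.eq_or_lt with rfl | hδ
    · have hz : ∀ j, q j * (1 - ∑ i ∈ S j, p i) = 0 := fun j => le_antisymm
        ((Finset.single_le_sum (fun i _ => mul_nonneg (hq i) (sub_nonneg.2 (hle1 i)))
          (Finset.mem_univ j)).trans (by simpa using hdef))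
        (mul_nonneg (hq j) (sub_nonneg.2 (hle1 j)))
      have hlt : ∀ j, 0 < q j → R * q j < (S j).card := fun j hj => by
        have h1 := (mul_eq_zero.1 (hz j)).resolve_left hj.ne'
        have := hcon j hj (by linarith)
        linarith
      have : ∑ j, R * q j < ∑ j, ((S j).card : ℝ) :=
        Finset.sum_lt_sum (fun j _ => by
          rcases (hq j).eq_or_lt with h | h
          · simp [← h]
          · exact (hlt j h).le) ⟨j0, Finset.mem_univ _, hlt j0 hj0⟩
      rw [← Finset.mul_sum, hq1] at this
      linarith
    · have hlt : ∀ j, 0 < q j → δ * (R * q j) <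
          δ * ((1 - δ) * (S j).card) + R * (q j * (1 - ∑ i ∈ S j, p i)) := fun j hj => by
        rcases le_or_gt (1 - δ) (∑ i ∈ S j, p i) with h | h
        · have h1 := hcon j hj h
          have h2 : 0 ≤ R * (q j * (1 - ∑ i ∈ S j, p i)) :=
            mul_nonneg hRpos.le (mul_nonneg (hq j) (sub_nonneg.2 (hle1 j)))
          nlinarith
        · have h1 : 0 < (R * q j) * ((1 - ∑ i ∈ S j, p i) - δ) :=
            mul_pos (mul_pos hRpos hj) (by linarith)
          have h2 : 0 ≤ δ * ((1 - δ) * (S j).card) := by positivity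
          nlinarith
      have : ∑ j, δ * (R * q j) <
          ∑ j, (δ * ((1 - δ) * (S j).card) + R * (q j * (1 - ∑ i ∈ S j, p i))) :=
        Finset.sum_lt_sum (fun j _ => by
          rcases (hq j).eq_or_lt with h | h
          · simp only [← h, mul_zero, zero_mul, add_zero]; positivity
          · exact (hlt j h).le) ⟨j0, Finset.mem_univ _, hlt j0 hj0⟩
      rw [Finset.sum_add_distrib, ← Finset.mul_sum, ← Finset.mul_sum, ← Finset.mul_sum,
        ← Finset.mul_sum, ← Finset.mul_sum, hq1] at this
      have a1 := mul_le_mul_of_nonneg_left hcard (mul_nonneg hδ.le hδ'.le)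
      have a2 := mul_le_mul_of_nonneg_left hdef hRpos.le
      nlinarith
  have hJ : (S j).Nonempty := by
    rw [Finset.nonempty_iff_ne_empty]
    intro h
    rw [h, Finset.sum_empty] at hpj
    linarith
  refine ⟨S j, hJ, hpj, ?_⟩
  obtain ⟨i, hi, hsup⟩ := Finset.exists_mem_eq_sup' hJ p
  rw [hsup, le_div_iff₀ (by positivity)]
  have hi' := hGL (i, j) (Finset.mem_filter.1 hi).2
  dsimp only at hi'
  have h1 := mul_le_mul_of_nonneg_right hcj (mul_nonneg hδ'.le (hp i))
  have h2 := mul_le_mul_of_nonneg_left hi' hRpos.le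
  nlinarith

/-! ### Eigenvalues and the entropy spread `Delta` -/

/-- With no weight to spare, every admissible `J` contains the support of `f`. All of them have the
same maximum, and the support is the smallest. -/
theorem sInf_spread_zero {n : Type} [Fintype n] [DecidableEq n] [Nonempty n] (f : n → ℝ)
    (hf : ∀ i, 0 ≤ f i) (hf1 : ∑ i, f i = 1) :
    sInf {x : ℝ | ∃ (J : Finset n) (hJ : J.Nonempty),
      1 - 0 ≤ ∑ j ∈ J, f j ∧ x = (J.card : ℝ) * J.sup' hJ f} =
    ((Finset.univ.filter fun i => f i ≠ 0).card : ℝ) *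
      Finset.univ.sup' Finset.univ_nonempty f := by
  have hsupp : ∀ J : Finset n, 1 ≤ ∑ j ∈ J, f j → ∀ i, f i ≠ 0 → i ∈ J := by
    intro J hJ i hi
    by_contra hiJ
    have h := Finset.sum_le_univ_sum_of_nonneg (s := insert i J) hf
    rw [Finset.sum_insert hiJ, hf1] at h
    exact hi (le_antisymm (by linarith) (hf i))
  have hsup : ∀ (J : Finset n) (hJ : J.Nonempty), 1 ≤ ∑ j ∈ J, f j →
      J.sup' hJ f = Finset.univ.sup' Finset.univ_nonempty f := by
    intro J hJ h1
    refine le_antisymm (Finset.sup'_mono f (Finset.subset_univ _) hJ) ?_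
    refine Finset.sup'_le _ _ fun i _ => ?_
    by_cases hi : f i = 0
    · obtain ⟨j, hj⟩ := hJ
      rw [hi]
      exact (hf j).trans (Finset.le_sup' f hj)
    · exact Finset.le_sup' f (hsupp J h1 i hi)
  have hS1 : ∑ i with f i ≠ 0, f i = 1 := by rw [Finset.sum_filter_ne_zero, hf1]
  have hSn : (Finset.univ.filter fun i => f i ≠ 0).Nonempty := by
    rw [Finset.nonempty_iff_ne_empty]
    intro h
    rw [h] at hS1
    simp at hS1
  refine IsLeast.csInf_eq ⟨⟨_, hSn, by simp [hS1], by rw [hsup _ hSn hS1.ge]⟩, ?_⟩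
  rintro x ⟨J, hJ, h1, rfl⟩
  rw [sub_zero] at h1
  rw [hsup J hJ h1]
  refine mul_le_mul_of_nonneg_right ?_ ?_
  · exact_mod_cast Finset.card_le_card fun i hi => hsupp J h1 i (Finset.mem_filter.1 hi).2
  · obtain ⟨i⟩ := ‹Nonempty n›
    exact (hf i).trans (Finset.le_sup' f (Finset.mem_univ i))

namespace DensityOperator

variable {n : Type} [Fintype n] [DecidableEq n] (ρ : DensityOperator n)

theorem eig_nonneg (i : n) : 0 ≤ ρ.eig i := ρ.posSemidef.eigenvalues_nonneg i

theorem sum_eig : ∑ i, ρ.eig i = 1 := by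
  have h := ρ.posSemidef.isHermitian.trace_eq_sum_eigenvalues
  rw [ρ.trace_eq_one] at h
  have h' : ((∑ i, ρ.eig i : ℝ) : ℂ) = 1 := by rw [h, Complex.ofReal_sum]; rfl
  exact_mod_cast h'

theorem nonempty_index (ρ : DensityOperator n) : Nonempty n := by
  by_contra h
  rw [not_nonempty_iff] at h
  simpa using ρ.sum_eig

/-- The largest eigenvalue. -/
noncomputable def maxEig : ℝ :=
  haveI := ρ.nonempty_index
  Finset.univ.sup' Finset.univ_nonempty ρ.eig

theorem eig_le_maxEig (i : n) : ρ.eig i ≤ ρ.maxEig := Finset.le_sup' ρ.eig (Finset.mem_univ i)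

/-- The number of nonzero eigenvalues. -/
noncomputable def suppCard : ℕ := (Finset.univ.filter fun i => ρ.eig i ≠ 0).card

theorem Delta_zero_eq : Delta 0 ρ = Real.logb 2 (ρ.suppCard * ρ.maxEig) := by
  have := ρ.nonempty_index
  rw [Delta, sInf_spread_zero ρ.eig ρ.eig_nonneg ρ.sum_eig]
  rfl

theorem exists_eig_pos : ∃ i, 0 < ρ.eig i := by
  by_contra! h
  linarith [ρ.sum_eig, Finset.sum_nonpos fun j (_ : j ∈ Finset.univ) => h j]

theorem maxEig_pos : 0 < ρ.maxEig := by
  obtain ⟨i, hi⟩ := ρ.exists_eig_pos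
  exact hi.trans_le (ρ.eig_le_maxEig i)

theorem suppCard_pos : 0 < ρ.suppCard := by
  obtain ⟨i, hi⟩ := ρ.exists_eig_pos
  exact Finset.card_pos.2 ⟨i, by simp [hi.ne']⟩

theorem Delta_le {δ : ℝ} (hδ : δ < 1) {x : ℝ} (J : Finset n) (hJ : J.Nonempty)
    (h1 : 1 - δ ≤ ∑ j ∈ J, ρ.eig j) (hx : J.card * J.sup' hJ ρ.eig ≤ x) :
    Delta δ ρ ≤ Real.logb 2 x := by
  -- This bound makes the infimum positive, as monotonicity of the logarithm requires.
  have hlow : ∀ y ∈ {x : ℝ | ∃ (J : Finset n) (hJ : J.Nonempty),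
      1 - δ ≤ ∑ j ∈ J, ρ.eig j ∧ x = (J.card : ℝ) * J.sup' hJ ρ.eig}, 1 - δ ≤ y := by
    rintro y ⟨J, hJ, h1, rfl⟩
    refine h1.trans ?_
    rw [← nsmul_eq_mul]
    exact Finset.sum_le_card_nsmul _ _ _ fun j hj => Finset.le_sup' _ hj
  have hmem : (J.card : ℝ) * J.sup' hJ ρ.eig ∈ {x : ℝ | ∃ (J : Finset n) (hJ : J.Nonempty),
      1 - δ ≤ ∑ j ∈ J, ρ.eig j ∧ x = (J.card : ℝ) * J.sup' hJ ρ.eig} := ⟨J, hJ, h1, rfl⟩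
  refine Real.logb_le_logb_of_le one_lt_two ?_ ((csInf_le ⟨_, hlow⟩ hmem).trans hx)
  exact (sub_pos.2 hδ).trans_le (le_csInf ⟨_, hmem⟩ hlow)

end DensityOperator

/-! ### Overlaps of coefficient matrices and their Schmidt weights -/

/-- The squared Euclidean norm of a row. -/
noncomputable def rowSq {X Y : Type} [Fintype Y] (M : Matrix X Y ℂ) (x : X) : ℝ :=
  ∑ y, ‖M x y‖ ^ 2

theorem rowSq_nonneg {X Y : Type} [Fintype Y] (M : Matrix X Y ℂ) (x : X) : 0 ≤ rowSq M x :=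
  Finset.sum_nonneg fun _ _ => sq_nonneg _

theorem mul_conjTranspose_self_apply_self {X Y : Type} [Fintype Y] (M : Matrix X Y ℂ) (x : X) :
    (M * Mᴴ) x x = (rowSq M x : ℂ) := by
  simp [Matrix.mul_apply, rowSq, Complex.mul_conj, Complex.normSq_eq_norm_sq]

theorem norm_sum_mul_le_sqrt {ι : Type} [Fintype ι] (f g : ι → ℂ) :
    ‖∑ i, f i * g i‖ ≤ √(∑ i, ‖f i‖ ^ 2) * √(∑ i, ‖g i‖ ^ 2) := by
  refine (norm_sum_le _ _).trans ?_
  simp only [norm_mul]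
  exact Real.sum_mul_le_sqrt_mul_sqrt _ _ _

theorem norm_sum_mul_sq_le {ι : Type} [Fintype ι] (f g : ι → ℂ) :
    ‖∑ i, f i * g i‖ ^ 2 ≤ (∑ i, ‖f i‖ ^ 2) * ∑ i, ‖g i‖ ^ 2 := by
  refine (pow_le_pow_left₀ (norm_nonneg _) (norm_sum_mul_le_sqrt f g) 2).trans_eq ?_
  rw [mul_pow, Real.sq_sqrt (Finset.sum_nonneg fun _ _ => sq_nonneg _),
    Real.sq_sqrt (Finset.sum_nonneg fun _ _ => sq_nonneg _)]

/-- Cauchy–Schwarz in each row: the overlap of two vectors is at most the classical overlap of their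
row weights. -/
theorem norm_trace_conjTranspose_mul_le {X Y : Type} [Fintype X] [Fintype Y]
    (A B : Matrix X Y ℂ) : ‖(Aᴴ * B).trace‖ ≤ ∑ x, √(rowSq A x) * √(rowSq B x) := by
  have h : (Aᴴ * B).trace = ∑ x, ∑ y, star (A x y) * B x y := by
    rw [Finset.sum_comm]
    simp [Matrix.trace, Matrix.mul_apply]
  rw [h]
  refine (norm_sum_le _ _).trans (Finset.sum_le_sum fun x _ => ?_)
  refine (norm_sum_mul_le_sqrt _ _).trans_eq ?_
  simp [rowSq]

/-- The diagonal entries of `V * diagonal r * Vᴴ`. For unitary `V` the new row weights are averages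
of `r` under a doubly stochastic matrix. -/
theorem rowSq_mul_of_diagonal {K X Y : Type} [Fintype X] [DecidableEq X] [Fintype Y]
    (V : Matrix K X ℂ) (A : Matrix X Y ℂ) (r : X → ℝ)
    (hA : A * Aᴴ = Matrix.diagonal fun x => (r x : ℂ)) (k : K) :
    rowSq (V * A) k = ∑ x, r x * ‖V k x‖ ^ 2 := by
  have h := mul_conjTranspose_self_apply_self (V * A) k
  rw [Matrix.conjTranspose_mul, Matrix.mul_assoc, ← Matrix.mul_assoc A, hA] at h
  rw [Matrix.mul_apply] at h
  simp only [Matrix.diagonal_mul, Matrix.conjTranspose_apply] at h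
  have h' : ∀ x, V k x * ((r x : ℂ) * star (V k x)) = ((r x * ‖V k x‖ ^ 2 : ℝ) : ℂ) := by
    intro x
    have : V k x * star (V k x) = ((‖V k x‖ ^ 2 : ℝ) : ℂ) := by
      rw [← Complex.normSq_eq_norm_sq, ← Complex.mul_conj]; rfl
    rw [Complex.ofReal_mul, ← this]
    ring
  simp only [h'] at h
  exact_mod_cast h.symm

theorem rowSq_of_diagonal {X Y : Type} [Fintype X] [DecidableEq X] [Fintype Y]
    (A : Matrix X Y ℂ) (r : X → ℝ)
    (hA : A * Aᴴ = Matrix.diagonal fun x => (r x : ℂ)) (x : X) : rowSq A x = r x := by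
  have h := mul_conjTranspose_self_apply_self A x
  rw [hA, Matrix.diagonal_apply_eq] at h
  exact_mod_cast h.symm

theorem rowSq_of_mul_conjTranspose_eq_one {X Y : Type} [DecidableEq X] [Fintype Y]
    (V : Matrix X Y ℂ) (hV : V * Vᴴ = 1) (x : X) : ∑ y, ‖V x y‖ ^ 2 = 1 := by
  have h := mul_conjTranspose_self_apply_self V x
  rw [hV, Matrix.one_apply_eq] at h
  exact_mod_cast h.symm

theorem colSq_of_conjTranspose_mul_eq_one {X Y : Type} [Fintype X] [DecidableEq Y]
    (V : Matrix X Y ℂ) (hV : Vᴴ * V = 1) (y : Y) : ∑ x, ‖V x y‖ ^ 2 = 1 := by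
  have h := rowSq_of_mul_conjTranspose_eq_one Vᴴ (by simpa using hV) y
  simpa using h

/-- If two vectors have overlap close to one, the `R` largest Schmidt weights of one of them, `R`
being the Schmidt rank of the other, have weight close to one. -/
theorem exists_finset_overlap_le {K X Y : Type} [Fintype K] [DecidableEq K] [Fintype X]
    [DecidableEq X] [Fintype Y] (V : Matrix K X ℂ) (hV : V * Vᴴ = 1) (hV' : Vᴴ * V = 1)
    (A : Matrix X Y ℂ) (B : Matrix K Y ℂ) (r : X → ℝ) (w : K → ℝ)
    (hA : A * Aᴴ = Matrix.diagonal fun x => (r x : ℂ))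
    (hB : B * Bᴴ = Matrix.diagonal fun k => (w k : ℂ)) (hr1 : ∑ x, r x = 1) :
    ∃ T : Finset K, T.card ≤ (Finset.univ.filter fun x => r x ≠ 0).card ∧
      ‖((V * A)ᴴ * B).trace‖ ^ 2 ≤ ∑ k ∈ T, w k := by
  have hr0 : ∀ x, 0 ≤ r x := fun x => rowSq_of_diagonal A r hA x ▸ rowSq_nonneg _ _
  have hw0 : ∀ x, 0 ≤ w x := fun x => rowSq_of_diagonal B w hB x ▸ rowSq_nonneg _ _
  set D := Finset.univ.filter fun x => r x ≠ 0 with hD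
  have hrow : ∀ l, rowSq (Vᴴ * B) l = ∑ k, w k * ‖V k l‖ ^ 2 := fun l => by
    rw [rowSq_mul_of_diagonal Vᴴ B w hB]
    simp
  -- The selection is the diagonal of the projector onto the support of `r`, written in the basis
  -- `K`: entries at most one, trace `D.card`.
  obtain ⟨T, hT, hle⟩ := exists_finset_card_le_sum_mul_le w (fun k => ∑ l ∈ D, ‖V k l‖ ^ 2) D.card
    hw0 (fun k => Finset.sum_nonneg fun _ _ => sq_nonneg _)
    (fun k => (Finset.sum_le_univ_sum_of_nonneg fun _ => sq_nonneg _).trans_eq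
      (rowSq_of_mul_conjTranspose_eq_one V hV k))
    (by
      rw [Finset.sum_comm]
      simp [colSq_of_conjTranspose_mul_eq_one V hV'])
  refine ⟨T, hT, le_trans ?_ hle⟩
  have h1 : ‖((V * A)ᴴ * B).trace‖ ≤ ∑ l ∈ D, √(r l) * √(rowSq (Vᴴ * B) l) := by
    rw [Matrix.conjTranspose_mul, Matrix.mul_assoc]
    refine (norm_trace_conjTranspose_mul_le _ _).trans_eq ?_
    simp only [rowSq_of_diagonal A r hA]
    symm
    refine Finset.sum_subset (Finset.subset_univ _) fun l _ hl => ?_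
    have : r l = 0 := by simpa [hD] using hl
    simp [this]
  have h2 := h1.trans (Real.sum_mul_le_sqrt_mul_sqrt D _ _)
  refine (pow_le_pow_left₀ (norm_nonneg _) h2 2).trans ?_
  rw [mul_pow, Real.sq_sqrt (Finset.sum_nonneg fun _ _ => sq_nonneg _),
    Real.sq_sqrt (Finset.sum_nonneg fun _ _ => sq_nonneg _)]
  have e1 : ∑ l ∈ D, √(r l) ^ 2 ≤ 1 := by
    simp only [Real.sq_sqrt (hr0 _)]
    exact hr1 ▸ Finset.sum_le_univ_sum_of_nonneg hr0
  have e2 : ∑ l ∈ D, √(rowSq (Vᴴ * B) l) ^ 2 = ∑ k, w k * ∑ l ∈ D, ‖V k l‖ ^ 2 := by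
    have hsq : ∀ l, √(rowSq (Vᴴ * B) l) ^ 2 = ∑ k, w k * ‖V k l‖ ^ 2 := fun l => by
      rw [Real.sq_sqrt (rowSq_nonneg _ _), hrow]
    simp only [hsq, Finset.mul_sum]
    exact Finset.sum_comm
  rw [← e2]
  exact mul_le_of_le_one_left (Finset.sum_nonneg fun _ _ => sq_nonneg _) e1

/-- The rank of `A` gives a small set `T` of weight at least `1 - ε`; the bound `L` on its weights
lets the elements with `(1 - δ) * w k > L` be dropped at a cost of at most `δ ^ 2 - ε`. -/
theorem exists_heavy_finset {K X Y : Type} [Fintype K] [DecidableEq K] [Fintype X]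
    [DecidableEq X] [Fintype Y] (V : Matrix K X ℂ) (hV : V * Vᴴ = 1) (hV' : Vᴴ * V = 1)
    (A : Matrix X Y ℂ) (B : Matrix K Y ℂ) (r : X → ℝ) (w : K → ℝ)
    (hA : A * Aᴴ = Matrix.diagonal fun x => (r x : ℂ))
    (hB : B * Bᴴ = Matrix.diagonal fun k => (w k : ℂ))
    (hr1 : ∑ x, r x = 1) (hw1 : ∑ k, w k = 1) (L ε δ : ℝ) (hL : ∀ x, r x ≤ L)
    (hδ0 : 0 ≤ δ) (hδ1 : δ < 1) (hε : 4 * ε = δ ^ 8)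
    (hf : 1 - ε ≤ ‖((V * A)ᴴ * B).trace‖ ^ 2) :
    ∃ G : Finset K, G.card ≤ (Finset.univ.filter fun x => r x ≠ 0).card ∧
      (∀ k ∈ G, (1 - δ) * w k ≤ L) ∧ 1 - δ ^ 2 ≤ ∑ k ∈ G, w k := by
  have hr0 : ∀ x, 0 ≤ r x := fun x => rowSq_of_diagonal A r hA x ▸ rowSq_nonneg _ _
  have hw0 : ∀ x, 0 ≤ w x := fun x => rowSq_of_diagonal B w hB x ▸ rowSq_nonneg _ _
  obtain ⟨T, hT, hle⟩ := exists_finset_overlap_le V hV hV' A B r w hA hB hr1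
  have hm := rowSq_mul_of_diagonal V A r hA
  have hm1 : ∑ k, rowSq (V * A) k = 1 := by
    simp only [hm]
    rw [Finset.sum_comm]
    simp only [← Finset.mul_sum, colSq_of_conjTranspose_mul_eq_one V hV', mul_one, hr1]
  have hmL : ∀ k, rowSq (V * A) k ≤ L := fun k => by
    rw [hm]
    refine (Finset.sum_le_sum fun x _ =>
      mul_le_mul_of_nonneg_right (hL x) (sq_nonneg _)).trans_eq ?_
    rw [← Finset.mul_sum, rowSq_of_mul_conjTranspose_eq_one V hV, mul_one]
  have hε0 : 0 ≤ ε := by nlinarith [pow_nonneg hδ0 8]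
  have hε1 : ε ≤ 1 := by nlinarith [pow_le_one₀ (n := 8) hδ0 hδ1.le]
  have htr : 1 - ε ≤ ‖((V * A)ᴴ * B).trace‖ :=
    le_of_sq_le_sq (le_trans (by nlinarith) hf) (norm_nonneg _)
  have hsum := htr.trans (norm_trace_conjTranspose_mul_le (V * A) B)
  simp only [rowSq_of_diagonal B w hB] at hsum
  have hbig := sum_filter_le_sq_sub _ w L ε δ (rowSq_nonneg (V * A)) hw0 hm1 hw1 hmL hδ0 hδ1 hε hsum
  refine ⟨T.filter fun k => (1 - δ) * w k ≤ L, (Finset.card_filter_le _ _).trans hT,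
    fun k hk => (Finset.mem_filter.1 hk).2, ?_⟩
  have hsplit := Finset.sum_filter_add_sum_filter_not T (fun k => (1 - δ) * w k ≤ L) w
  have hrest : ∑ k ∈ T with ¬ (1 - δ) * w k ≤ L, w k ≤ ∑ k with L < (1 - δ) * w k, w k :=
    Finset.sum_le_sum_of_subset_of_nonneg (fun k hk => by simpa using (Finset.mem_filter.1 hk).2)
      fun k _ _ => hw0 k
  linarith

/-- The coefficient matrix of a bipartite vector. -/
def coeffMatrix {A B : Type} (φ : A × B → ℂ) : Matrix A B ℂ := Matrix.of fun a b => φ (a, b)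

theorem trRight_ketbra_eq {A B : Type} [Fintype A] [Fintype B] (φ : A × B → ℂ) :
    trRight (ketbra φ) = coeffMatrix φ * (coeffMatrix φ)ᴴ := by
  ext a a'
  simp [trRight, ketbra, coeffMatrix, Matrix.mul_apply, Matrix.vecMulVec_apply]

theorem DensityOperator.exists_unitary {n : Type} [Fintype n] [DecidableEq n]
    (ρ : DensityOperator n) : ∃ U : Matrix n n ℂ, U * Uᴴ = 1 ∧ Uᴴ * U = 1 ∧
      Uᴴ * ρ.mat * U = Matrix.diagonal fun i => (ρ.eig i : ℂ) := by
  have hU := ρ.posSemidef.isHermitian.eigenvectorUnitary.2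
  refine ⟨ρ.posSemidef.isHermitian.eigenvectorUnitary, Matrix.mem_unitaryGroup_iff.1 hU,
    Matrix.mem_unitaryGroup_iff'.1 hU, ?_⟩
  have h := ρ.posSemidef.isHermitian.conjStarAlgAut_star_eigenvectorUnitary
  rw [Unitary.conjStarAlgAut_apply] at h
  simp only [Unitary.coe_star, star_star] at h
  exact h

/-- A pure state close to `ψ ⊗ χ` has at least the entanglement spread of `ψ`, up to smoothing. -/
theorem Delta_le_of_overlap {S T A B : Type} [Fintype S] [DecidableEq S] [Fintype T]
    [Fintype A] [DecidableEq A] [Fintype B]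
    (ψ : PureState S T) (χ : PureState A B) (Φ : PureState (S × A) (T × B)) (ε δ : ℝ)
    (hδ0 : 0 ≤ δ) (hδ1 : δ < 1) (hε : 4 * ε = δ ^ 8)
    (hf : 1 - ε ≤ ‖((coeffMatrix Φ.vec)ᴴ *
      (coeffMatrix ψ.vec ⊗ₖ coeffMatrix χ.vec)).trace‖ ^ 2) :
    Delta δ ψ.reduced ≤ Real.logb 2
      (Φ.reduced.suppCard * Φ.reduced.maxEig / (1 - δ) ^ 2) := by
  obtain ⟨U₁, h₁, h₁', hd₁⟩ := ψ.reduced.exists_unitary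
  obtain ⟨U₂, h₂, h₂', hd₂⟩ := χ.reduced.exists_unitary
  obtain ⟨E, hE, hE', hdE⟩ := Φ.reduced.exists_unitary
  have hψ : ψ.reduced.mat = _ := trRight_ketbra_eq ψ.vec
  have hχ : χ.reduced.mat = _ := trRight_ketbra_eq χ.vec
  have hΦ : Φ.reduced.mat = _ := trRight_ketbra_eq Φ.vec
  rw [hψ] at hd₁
  rw [hχ] at hd₂
  rw [hΦ] at hdE
  set M := coeffMatrix Φ.vec
  set N₁ := coeffMatrix ψ.vec
  set N₂ := coeffMatrix χ.vec
  have hUU : (U₁ ⊗ₖ U₂) * (U₁ ⊗ₖ U₂)ᴴ = 1 := by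
    rw [Matrix.conjTranspose_kronecker, ← Matrix.mul_kronecker_mul, h₁, h₂,
      Matrix.one_kronecker_one]
  have hUU' : (U₁ ⊗ₖ U₂)ᴴ * (U₁ ⊗ₖ U₂) = 1 := by
    rw [Matrix.conjTranspose_kronecker, ← Matrix.mul_kronecker_mul, h₁', h₂',
      Matrix.one_kronecker_one]
  set U := U₁ ⊗ₖ U₂ with hU
  have hB : (Uᴴ * (N₁ ⊗ₖ N₂)) * (Uᴴ * (N₁ ⊗ₖ N₂))ᴴ =
      Matrix.diagonal fun x : S × A => ((ψ.reduced.eig x.1 * χ.reduced.eig x.2 : ℝ) : ℂ) := by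
    have : (Uᴴ * (N₁ ⊗ₖ N₂)) * (Uᴴ * (N₁ ⊗ₖ N₂))ᴴ =
        (U₁ᴴ * (N₁ * N₁ᴴ) * U₁) ⊗ₖ (U₂ᴴ * (N₂ * N₂ᴴ) * U₂) := by
      simp only [hU, Matrix.conjTranspose_mul, Matrix.conjTranspose_kronecker,
        Matrix.conjTranspose_conjTranspose, ← Matrix.mul_kronecker_mul, Matrix.mul_assoc]
    rw [this, hd₁, hd₂, Matrix.diagonal_kronecker_diagonal]
    simp
  have hA : (Eᴴ * M) * (Eᴴ * M)ᴴ = Matrix.diagonal fun x => (Φ.reduced.eig x : ℂ) := by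
    rw [← hdE]
    simp only [Matrix.conjTranspose_mul, Matrix.conjTranspose_conjTranspose, Matrix.mul_assoc]
  -- `Uᴴ * E` is the change of basis between the Schmidt bases of `Φ` and `ψ ⊗ χ` on Alice's side.
  -- Bob's bases need no rotation, since only row weights enter.
  have hV : (Uᴴ * E) * (Uᴴ * E)ᴴ = 1 := by
    rw [Matrix.conjTranspose_mul, Matrix.conjTranspose_conjTranspose, Matrix.mul_assoc,
      ← Matrix.mul_assoc E, hE, Matrix.one_mul, hUU']
  have hV' : (Uᴴ * E)ᴴ * (Uᴴ * E) = 1 := by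
    rw [Matrix.conjTranspose_mul, Matrix.conjTranspose_conjTranspose, Matrix.mul_assoc,
      ← Matrix.mul_assoc U, hUU, Matrix.one_mul, hE']
  have htr : (Uᴴ * E * (Eᴴ * M))ᴴ * (Uᴴ * (N₁ ⊗ₖ N₂)) = Mᴴ * (N₁ ⊗ₖ N₂) := by
    have : Uᴴ * E * (Eᴴ * M) = Uᴴ * M := by
      rw [Matrix.mul_assoc, ← Matrix.mul_assoc E, hE, Matrix.one_mul]
    rw [this, Matrix.conjTranspose_mul, Matrix.conjTranspose_conjTranspose, Matrix.mul_assoc,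
      ← Matrix.mul_assoc U, hUU, Matrix.one_mul]
  have hw1 : ∑ x : S × A, ψ.reduced.eig x.1 * χ.reduced.eig x.2 = 1 := by
    rw [Fintype.sum_prod_type]
    simp only [← Finset.mul_sum, DensityOperator.sum_eig, mul_one]
  obtain ⟨G, hG, hGL, hGw⟩ := exists_heavy_finset (Uᴴ * E) hV hV' _ _ _ _ hA hB
    Φ.reduced.sum_eig hw1 Φ.reduced.maxEig ε δ Φ.reduced.eig_le_maxEig hδ0 hδ1 hε
    (by rw [htr]; exact hf)
  obtain ⟨J, hJ, hJ1, hJ2⟩ := exists_heavy_section ψ.reduced.eig χ.reduced.eig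
    ψ.reduced.eig_nonneg χ.reduced.eig_nonneg ψ.reduced.sum_eig χ.reduced.sum_eig G _ _ δ hδ0 hδ1
    hG hGL hGw
  exact ψ.reduced.Delta_le hδ1 J hJ hJ1 hJ2

/-! ### Schmidt rank and coefficients under local isometries and communication -/

/-- The Schmidt rank is at most `r`. -/
def SchmidtRankLE {A B : Type} (r : ℕ) (φ : A × B → ℂ) : Prop :=
  ∃ (K : Type) (_ : Fintype K) (f : K → A → ℂ) (g : K → B → ℂ), Fintype.card K ≤ r ∧
    ∀ a b, φ (a, b) = ∑ k, f k a * g k b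

/-- The squared Schmidt coefficients are at most `l`, stated for the associated bilinear form. -/
def SchmidtCoeffLE {A B : Type} [Fintype A] [Fintype B] (l : ℝ) (φ : A × B → ℂ) : Prop :=
  ∀ (x : A → ℂ) (y : B → ℂ),
    ‖∑ a, ∑ b, x a * y b * φ (a, b)‖ ^ 2 ≤ l * (∑ a, ‖x a‖ ^ 2) * ∑ b, ‖y b‖ ^ 2

theorem SchmidtRankLE.swap {A B : Type} {r : ℕ} {φ : A × B → ℂ} (h : SchmidtRankLE r φ) :
    SchmidtRankLE r fun p : B × A => φ (p.2, p.1) := by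
  obtain ⟨K, iK, f, g, hK, hφ⟩ := h
  exact ⟨K, iK, g, f, hK, fun b a => by simp only [hφ, mul_comm]⟩

theorem SchmidtCoeffLE.swap {A B : Type} [Fintype A] [Fintype B] {l : ℝ} {φ : A × B → ℂ}
    (h : SchmidtCoeffLE l φ) : SchmidtCoeffLE l fun p : B × A => φ (p.2, p.1) := by
  intro x y
  have h' := h y x
  rw [Finset.sum_comm]
  simp only [mul_comm (x _)]
  rwa [mul_right_comm]

theorem sum_norm_sq_swap {A B : Type} [Fintype A] [Fintype B] (φ : A × B → ℂ) :
    ∑ p : B × A, ‖φ (p.2, p.1)‖ ^ 2 = ∑ p, ‖φ p‖ ^ 2 :=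
  Fintype.sum_equiv (Equiv.prodComm B A) _ _ fun _ => rfl

theorem sum_norm_sq_mulVec_of_isometry {A A' : Type} [Fintype A] [DecidableEq A] [Fintype A']
    (U : Matrix A' A ℂ) (hU : Uᴴ * U = 1) (v : A → ℂ) :
    ∑ a', ‖∑ a, U a' a * v a‖ ^ 2 = ∑ a, ‖v a‖ ^ 2 := by
  have hA : Uᵀ * Uᵀᴴ = Matrix.diagonal fun _ => ((1 : ℝ) : ℂ) := by
    have := congrArg Matrix.transpose hU
    rw [Matrix.transpose_mul, Matrix.transpose_one] at this
    rw [Complex.ofReal_one, Matrix.diagonal_one, ← this]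
    rfl
  have h := rowSq_mul_of_diagonal (Matrix.of fun (_ : Unit) a => v a) Uᵀ (fun _ => 1) hA ()
  simpa [rowSq, Matrix.mul_apply, mul_comm] using h

/-- Duality: pairing `x` with the isometric image of the conjugate of `z` gives `s`, so
Cauchy–Schwarz yields `s ^ 2 ≤ ‖x‖ ^ 2 * s`. -/
theorem sum_norm_sq_vecMul_le_of_isometry {A A' : Type} [Fintype A] [DecidableEq A] [Fintype A']
    (U : Matrix A' A ℂ) (hU : Uᴴ * U = 1) (x : A' → ℂ) :
    ∑ a, ‖∑ a', x a' * U a' a‖ ^ 2 ≤ ∑ a', ‖x a'‖ ^ 2 := by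
  set z : A → ℂ := fun a => ∑ a', x a' * U a' a with hz
  set s := ∑ a, ‖z a‖ ^ 2 with hs
  have hs0 : 0 ≤ s := Finset.sum_nonneg fun _ _ => sq_nonneg _
  have h1 : (s : ℂ) = ∑ a', x a' * ∑ a, U a' a * star (z a) := by
    have : (s : ℂ) = ∑ a, z a * star (z a) := by
      rw [hs, Complex.ofReal_sum]
      refine Finset.sum_congr rfl fun a _ => ?_
      rw [← Complex.normSq_eq_norm_sq, ← Complex.mul_conj]
      rfl
    rw [this]
    simp only [Finset.mul_sum]
    rw [Finset.sum_comm]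
    refine Finset.sum_congr rfl fun a _ => ?_
    rw [hz, Finset.sum_mul]
    exact Finset.sum_congr rfl fun a' _ => mul_assoc _ _ _
  have h2 := norm_sum_mul_sq_le x fun a' => ∑ a, U a' a * star (z a)
  rw [← h1, sum_norm_sq_mulVec_of_isometry U hU] at h2
  simp only [norm_star, Complex.norm_real, Real.norm_eq_abs, sq_abs] at h2
  change s ^ 2 ≤ _ * s at h2
  rcases hs0.eq_or_lt with h | h
  · rw [← h]
    exact Finset.sum_nonneg fun _ _ => sq_nonneg _
  · exact le_of_mul_le_mul_right (by rwa [sq] at h2) h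

theorem SchmidtRankLE.actA {A A' B : Type} [Fintype A] {r : ℕ} {φ : A × B → ℂ} (h : SchmidtRankLE r φ) (U : Matrix A' A ℂ) :
    SchmidtRankLE r (actA U φ) := by
  obtain ⟨K, iK, f, g, hK, hφ⟩ := h
  refine ⟨K, iK, fun k a' => ∑ a, U a' a * f k a, g, hK, fun a' b => ?_⟩
  simp only [EntTransform.actA, hφ, Finset.mul_sum, Finset.sum_mul]
  rw [Finset.sum_comm]
  exact Finset.sum_congr rfl fun k _ => Finset.sum_congr rfl fun a _ => by ring

section actA

variable {A A' B : Type} [Fintype A] [DecidableEq A] [Fintype A'] [Fintype B]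

theorem SchmidtCoeffLE.actA {l : ℝ} (hl : 0 ≤ l) {φ : A × B → ℂ} (h : SchmidtCoeffLE l φ)
    (U : Matrix A' A ℂ) (hU : Uᴴ * U = 1) : SchmidtCoeffLE l (actA U φ) := by
  intro x y
  have h' := h (fun a => ∑ a', x a' * U a' a) y
  have e : ∑ a', ∑ b, x a' * y b * EntTransform.actA U φ (a', b) =
      ∑ a, ∑ b, (∑ a', x a' * U a' a) * y b * φ (a, b) := by
    simp only [EntTransform.actA, Finset.mul_sum, Finset.sum_mul]
    calc _ = ∑ a', ∑ a, ∑ b, x a' * y b * (U a' a * φ (a, b)) :=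
          Finset.sum_congr rfl fun _ _ => Finset.sum_comm
      _ = ∑ a, ∑ a', ∑ b, x a' * y b * (U a' a * φ (a, b)) := Finset.sum_comm
      _ = ∑ a, ∑ b, ∑ a', x a' * y b * (U a' a * φ (a, b)) :=
          Finset.sum_congr rfl fun _ _ => Finset.sum_comm
      _ = _ := Finset.sum_congr rfl fun _ _ => Finset.sum_congr rfl fun _ _ =>
          Finset.sum_congr rfl fun _ _ => by ring
  rw [e]
  refine h'.trans (mul_le_mul_of_nonneg_right (mul_le_mul_of_nonneg_left
    (sum_norm_sq_vecMul_le_of_isometry U hU x) hl) (Finset.sum_nonneg fun _ _ => sq_nonneg _))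

theorem sum_norm_sq_actA (φ : A × B → ℂ) (U : Matrix A' A ℂ) (hU : Uᴴ * U = 1) :
    ∑ p, ‖actA U φ p‖ ^ 2 = ∑ p, ‖φ p‖ ^ 2 := by
  rw [Fintype.sum_prod_type_right, Fintype.sum_prod_type_right]
  exact Finset.sum_congr rfl fun b _ => sum_norm_sq_mulVec_of_isometry U hU fun a => φ (a, b)

end actA

section regroup

variable {A A' B B' Q : Type} [Fintype Q] (α : A' × Q ≃ A) (β : Q × B ≃ B')
  {φ : A × B → ℂ} {φ' : A' × B' → ℂ}

/-- Expanding the transferred register `Q` in its basis turns each product term into `card Q`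
product terms. -/
theorem SchmidtRankLE.regroup {r : ℕ} (h : SchmidtRankLE r φ)
    (hφ : ∀ a q b, φ' (a, β (q, b)) = φ (α (a, q), b)) :
    SchmidtRankLE (r * Fintype.card Q) φ' := by
  classical
  obtain ⟨K, iK, f, g, hK, hfg⟩ := h
  refine ⟨K × Q, inferInstance, fun x a => f x.1 (α (a, x.2)),
    fun x b' => if (β.symm b').1 = x.2 then g x.1 (β.symm b').2 else 0, ?_, fun a b' => ?_⟩
  · rw [Fintype.card_prod]
    exact Nat.mul_le_mul_right _ hK
  · obtain ⟨⟨q, b⟩, rfl⟩ := β.surjective b'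
    rw [hφ, hfg, Fintype.sum_prod_type]
    simp

/-- The form splits into one piece per basis state `q`, bounded by testing `φ` on `x ⊗ q`. The full
norm of `x` recurs in every piece, so Cauchy–Schwarz over `q` costs the factor `card Q`. -/
theorem SchmidtCoeffLE.regroup [Fintype A] [Fintype A'] [Fintype B] [Fintype B'] {l : ℝ}
    (h : SchmidtCoeffLE l φ) (hl : 0 ≤ l) (hφ : ∀ a q b, φ' (a, β (q, b)) = φ (α (a, q), b)) :
    SchmidtCoeffLE (l * Fintype.card Q) φ' := by
  classical
  intro x y
  set X := ∑ a, ‖x a‖ ^ 2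
  have hX : 0 ≤ X := Finset.sum_nonneg fun _ _ => sq_nonneg _
  have hq : ∀ q, ‖∑ a, ∑ b, x a * y (β (q, b)) * φ' (a, β (q, b))‖ ^ 2 ≤
      (l * X) * ∑ b, ‖y (β (q, b))‖ ^ 2 := by
    intro q
    have h' := h (fun c => if (α.symm c).2 = q then x (α.symm c).1 else 0) fun b => y (β (q, b))
    rw [← α.sum_comp, ← α.sum_comp, Fintype.sum_prod_type, Fintype.sum_prod_type] at h'
    simp only [Equiv.symm_apply_apply] at h'
    have e1 : ∀ a, ∑ q', ‖if q' = q then x a else 0‖ ^ 2 = ‖x a‖ ^ 2 := fun a => by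
      rw [Finset.sum_eq_single q] <;> simp +contextual
    have e2 : ∀ a, ∑ q', ∑ b, (if q' = q then x a else 0) * y (β (q, b)) * φ (α (a, q'), b) =
        ∑ b, x a * y (β (q, b)) * φ' (a, β (q, b)) := fun a => by
      rw [Finset.sum_eq_single q] <;> simp +contextual [hφ]
    simpa only [e1, e2] using h'
  have hsum : ∑ a, ∑ b', x a * y b' * φ' (a, b') =
      ∑ q, ∑ a, ∑ b, x a * y (β (q, b)) * φ' (a, β (q, b)) := by
    refine Eq.trans (Finset.sum_congr rfl fun a _ => ?_) Finset.sum_comm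
    rw [← β.sum_comp, Fintype.sum_prod_type]
  have hy : ∑ b', ‖y b'‖ ^ 2 = ∑ q, ∑ b, ‖y (β (q, b))‖ ^ 2 := by
    rw [← β.sum_comp, Fintype.sum_prod_type]
  rw [hsum, hy]
  refine (pow_le_pow_left₀ (norm_nonneg _) (norm_sum_le _ _) 2).trans ?_
  refine (Finset.sum_sq_le_sum_mul_sum_of_sq_le_mul Finset.univ (f := fun _ => l * X)
    (g := fun q => ∑ b, ‖y (β (q, b))‖ ^ 2) (fun _ _ => mul_nonneg hl hX)
    (fun _ _ => Finset.sum_nonneg fun _ _ => sq_nonneg _) fun q _ => hq q).trans_eq ?_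
  simp only [Finset.sum_const, Finset.card_univ, nsmul_eq_mul]
  ring

theorem sum_norm_sq_regroup [Fintype A] [Fintype A'] [Fintype B] [Fintype B']
    (hφ : ∀ a q b, φ' (a, β (q, b)) = φ (α (a, q), b)) :
    ∑ p, ‖φ' p‖ ^ 2 = ∑ p, ‖φ p‖ ^ 2 := by
  rw [Fintype.sum_prod_type, Fintype.sum_prod_type, ← α.sum_comp, Fintype.sum_prod_type]
  refine Finset.sum_congr rfl fun a _ => ?_
  rw [← β.sum_comp, Fintype.sum_prod_type]
  simp only [hφ]

end regroup

/-- A unit vector with bounds on its Schmidt rank and its squared Schmidt coefficients. -/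
structure HasSpread {A B : Type} [Fintype A] [Fintype B] (r : ℕ) (l : ℝ) (φ : A × B → ℂ) :
    Prop where
  norm_eq : ∑ p, ‖φ p‖ ^ 2 = 1
  rank_le : SchmidtRankLE r φ
  coeff_le : SchmidtCoeffLE l φ
  rank_pos : 0 < r
  coeff_pos : 0 < l

namespace HasSpread

variable {A A' B B' : Type} [Fintype A] [Fintype A'] [Fintype B] [Fintype B'] {r : ℕ} {l : ℝ}
  {φ : A × B → ℂ}

theorem swap (h : HasSpread r l φ) : HasSpread r l fun p : B × A => φ (p.2, p.1) :=
  ⟨(sum_norm_sq_swap φ).trans h.norm_eq, h.rank_le.swap, h.coeff_le.swap, h.rank_pos, h.coeff_pos⟩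

theorem actA [DecidableEq A] (h : HasSpread r l φ) (U : Matrix A' A ℂ) (hU : Uᴴ * U = 1) :
    HasSpread r l (actA U φ) :=
  ⟨(sum_norm_sq_actA φ U hU).trans h.norm_eq, h.rank_le.actA U,
    h.coeff_le.actA h.coeff_pos.le U hU, h.rank_pos, h.coeff_pos⟩

theorem actB [DecidableEq B] (h : HasSpread r l φ) (V : Matrix B' B ℂ) (hV : Vᴴ * V = 1) :
    HasSpread r l (actB V φ) :=
  (h.swap.actA V hV).swap

theorem regroup {Q : Type} [Fintype Q] (h : HasSpread r l φ) (α : A' × Q ≃ A) (β : Q × B ≃ B')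
    {φ' : A' × B' → ℂ} (hφ : ∀ a q b, φ' (a, β (q, b)) = φ (α (a, q), b)) :
    0 < Fintype.card Q ∧ HasSpread (r * Fintype.card Q) (l * Fintype.card Q) φ' := by
  -- A register of dimension zero would leave no room for a unit vector.
  have hQ : 0 < Fintype.card Q := by
    by_contra hQ
    have := Fintype.card_eq_zero_iff.1 (Nat.eq_zero_of_not_pos hQ)
    have : IsEmpty A := α.symm.isEmpty
    simpa using h.norm_eq
  exact ⟨hQ, (sum_norm_sq_regroup α β hφ).trans h.norm_eq, h.rank_le.regroup α β hφ,
    h.coeff_le.regroup α β h.coeff_pos.le hφ, Nat.mul_pos h.rank_pos hQ,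
    mul_pos h.coeff_pos (by exact_mod_cast hQ)⟩

theorem afterSendA [DecidableEq A] {d : ℕ} (h : HasSpread r l φ) (U : Matrix (A' × Fin d) A ℂ)
    (hU : Uᴴ * U = 1) : 0 < d ∧ HasSpread (r * d) (l * d) (afterSendA U φ) := by
  simpa using (h.actA U hU).regroup (Equiv.refl _) (Equiv.refl _)
    (φ' := EntTransform.afterSendA U φ) fun _ _ _ => rfl

theorem afterSendB [DecidableEq B] {d : ℕ} (h : HasSpread r l φ) (V : Matrix (Fin d × B') B ℂ)
    (hV : Vᴴ * V = 1) : 0 < d ∧ HasSpread (r * d) (l * d) (afterSendB V φ) := by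
  have h' := (h.actB V hV).swap.regroup (Equiv.prodComm _ _) (Equiv.prodComm _ _)
    (φ' := fun p => EntTransform.afterSendB V φ (p.2, p.1)) fun _ _ _ => rfl
  rw [Fintype.card_fin] at h'
  exact ⟨h'.1, h'.2.swap⟩

end HasSpread

/-- Each round of communication increases the bounds on rank and coefficients by the dimension of
the system sent. -/
theorem Protocol.exists_purification {S T A B : Type} [Fintype S] [Fintype T] [Fintype A]
    [DecidableEq A] [Fintype B] [DecidableEq B] (P : Protocol S T A B) :
    ∀ (φ : A × B → ℂ) (r : ℕ) (l : ℝ), HasSpread r l φ →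
      ∃ (A' B' : Type) (_ : Fintype A') (_ : DecidableEq A') (_ : Fintype B')
        (Φ : (S × A') × (T × B') → ℂ) (r' : ℕ) (l' : ℝ), HasSpread r' l' Φ ∧
        P.output φ = trRight (ketbra fun p : (S × T) × (A' × B') =>
          Φ ((p.1.1, p.2.1), (p.1.2, p.2.2))) ∧
        Real.logb 2 (r' * l') = Real.logb 2 (r * l) + 2 * P.cost := by
  have step : ∀ {r d : ℕ} {l : ℝ}, 0 < r → 0 < l → 0 < d →
      Real.logb 2 ((r * d : ℕ) * (l * d)) = Real.logb 2 (r * l) + 2 * Real.logb 2 d := by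
    intro r d l hr hl hd
    have hr' : (r : ℝ) ≠ 0 := by positivity
    have hd' : (d : ℝ) ≠ 0 := by positivity
    rw [show (((r * d : ℕ) : ℝ) * (l * d)) = (r * l) * (d * d) by push_cast; ring,
      Real.logb_mul (by positivity) (by positivity), Real.logb_mul hd' hd']
    ring
  induction P with
  | @finish A B _ _ _ _ A' B' _ _ _ _ U V hU hV =>
    intro φ r l h
    exact ⟨A', B', inferInstance, inferInstance, inferInstance, actA U (actB V φ), r, l,
      (h.actB V hV).actA U hU, rfl, by simp [Protocol.cost]⟩
  | sendA d U hU rest ih =>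
    intro φ r l h
    obtain ⟨hd, h'⟩ := h.afterSendA U hU
    obtain ⟨A', B', i₁, i₂, i₃, Φ, r', l', hΦ, ho, hc⟩ := ih _ _ _ h'
    refine ⟨A', B', i₁, i₂, i₃, Φ, r', l', hΦ, ho, ?_⟩
    rw [hc, step h.rank_pos h.coeff_pos hd, Protocol.cost]
    ring
  | sendB d V hV rest ih =>
    intro φ r l h
    obtain ⟨hd, h'⟩ := h.afterSendB V hV
    obtain ⟨A', B', i₁, i₂, i₃, Φ, r', l', hΦ, ho, hc⟩ := ih _ _ _ h'
    refine ⟨A', B', i₁, i₂, i₃, Φ, r', l', hΦ, ho, ?_⟩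
    rw [hc, step h.rank_pos h.coeff_pos hd, Protocol.cost]
    ring

/-! ### Invariance of `Delta 0` under a maximally mixed qubit -/

/-- Both multisets are the roots of the same characteristic polynomial. The indexing of `eig` may
differ from that of `w`, hence multisets. -/
theorem DensityOperator.map_eig_eq {n : Type} [Fintype n] [DecidableEq n] (ρ : DensityOperator n)
    (U : Matrix n n ℂ) (hU : U * Uᴴ = 1) (w : n → ℝ)
    (h : Uᴴ * ρ.mat * U = Matrix.diagonal fun i => (w i : ℂ)) :
    Finset.univ.val.map ρ.eig = Finset.univ.val.map w := by
  have hc : ρ.mat.charpoly = (Matrix.diagonal fun i => (w i : ℂ)).charpoly := by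
    rw [← h, Matrix.mul_assoc, Matrix.charpoly_mul_comm, Matrix.mul_assoc, hU, Matrix.mul_one]
  have h1 := ρ.posSemidef.isHermitian.roots_charpoly_eq_eigenvalues
  rw [hc, Matrix.charpoly_diagonal, Polynomial.roots_prod _ _
    (Finset.prod_ne_zero_iff.2 fun i _ => Polynomial.X_sub_C_ne_zero _)] at h1
  simp only [Polynomial.roots_X_sub_C, Multiset.bind_singleton] at h1
  refine Multiset.map_injective Complex.ofReal_injective ?_
  simp only [Multiset.map_map]
  exact h1.symm

/-- Every eigenvalue is halved and its multiplicity doubled, so rank times norm is unchanged. -/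
theorem Delta_zero_tensor_mixedQubit {n : Type} [Fintype n] [DecidableEq n]
    (ρ : DensityOperator n) : Delta 0 (ρ.tensor mixedQubit) = Delta 0 ρ := by
  obtain ⟨U, hU, -, hd⟩ := ρ.exists_unitary
  have hmap := (ρ.tensor mixedQubit).map_eig_eq (U ⊗ₖ (1 : Matrix (Fin 2) (Fin 2) ℂ))
    (by rw [Matrix.conjTranspose_kronecker, ← Matrix.mul_kronecker_mul, hU]; simp)
    (fun x => ρ.eig x.1 / 2) (by
      rw [DensityOperator.tensor, Matrix.conjTranspose_kronecker, ← Matrix.mul_kronecker_mul,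
        ← Matrix.mul_kronecker_mul, hd]
      ext ⟨i, b⟩ ⟨j, c⟩
      by_cases hij : i = j <;> by_cases hbc : b = c <;>
        simp [mixedQubit, hij, hbc, div_eq_mul_inv])
  have hcard : (ρ.tensor mixedQubit).suppCard = 2 * ρ.suppCard := by
    have h := congrArg (Multiset.countP fun x : ℝ => x ≠ 0) hmap
    rw [Multiset.countP_map, Multiset.countP_map] at h
    change (ρ.tensor mixedQubit).suppCard =
      (Finset.univ.filter fun x : n × Fin 2 => ρ.eig x.1 / 2 ≠ 0).card at h
    have e : (Finset.univ.filter fun x : n × Fin 2 => ρ.eig x.1 / 2 ≠ 0) =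
        (Finset.univ.filter fun i => ρ.eig i ≠ 0) ×ˢ Finset.univ := by
      ext x
      simp
    rw [h, e, Finset.card_product, Finset.card_univ, Fintype.card_fin, mul_comm]
    rfl
  have hmax : (ρ.tensor mixedQubit).maxEig = ρ.maxEig / 2 := by
    refine le_antisymm (Finset.sup'_le _ _ fun x _ => ?_) ?_
    · have hx : (ρ.tensor mixedQubit).eig x ∈
          Finset.univ.val.map fun y : n × Fin 2 => ρ.eig y.1 / 2 :=
        hmap ▸ Multiset.mem_map_of_mem _ (Finset.mem_univ x)
      obtain ⟨y, -, hy⟩ := Multiset.mem_map.1 hx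
      rw [← hy]
      exact div_le_div_of_nonneg_right (ρ.eig_le_maxEig y.1) zero_le_two
    · rw [div_le_iff₀ two_pos]
      refine Finset.sup'_le _ _ fun i _ => ?_
      have hx : ρ.eig i / 2 ∈ Finset.univ.val.map (ρ.tensor mixedQubit).eig :=
        hmap ▸ Multiset.mem_map.2 ⟨(i, 0), Finset.mem_univ (i, (0 : Fin 2)), rfl⟩
      obtain ⟨y, -, hy⟩ := Multiset.mem_map.1 hx
      linarith [(ρ.tensor mixedQubit).eig_le_maxEig y]
  rw [DensityOperator.Delta_zero_eq, DensityOperator.Delta_zero_eq, hcard, hmax]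
  congr 1
  push_cast
  ring

/-! ### Fidelity with a pure state -/

-- The projector `P` onto `v` is its own square root and `P σ P = c P`, whose square root is `√c P`,
-- of trace `√c`.
open scoped MatrixOrder in
theorem fidelity_ketbra {n : Type} [Fintype n] [DecidableEq n] (v : n → ℂ)
    (hv : ∑ i, ‖v i‖ ^ 2 = 1) (σ : Matrix n n ℂ) (c : ℝ) (hc0 : 0 ≤ c)
    (hc : star v ⬝ᵥ (σ *ᵥ v) = c) : fidelity (ketbra v) σ = c := by
  have hvv : star v ⬝ᵥ v = 1 := by
    have : star v ⬝ᵥ v = ((∑ i, ‖v i‖ ^ 2 : ℝ) : ℂ) := by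
      rw [Complex.ofReal_sum]
      refine Finset.sum_congr rfl fun i _ => ?_
      rw [← Complex.normSq_eq_norm_sq, ← Complex.mul_conj, mul_comm]
      rfl
    rw [this, hv, Complex.ofReal_one]
  have hPP : ketbra v * ketbra v = ketbra v := by
    rw [ketbra, Matrix.vecMulVec_mul_vecMulVec, hvv, one_smul]
  have hP0 : (ketbra v).PosSemidef := Matrix.posSemidef_vecMulVec_self_star v
  have hP : CFC.sqrt (ketbra v) = ketbra v :=
    CFC.sqrt_unique hPP (Matrix.nonneg_iff_posSemidef.2 hP0)
  have hPσ : ketbra v * σ * ketbra v = (c : ℂ) • ketbra v := by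
    rw [Matrix.mul_assoc, ketbra, Matrix.mul_vecMulVec, Matrix.vecMulVec_mul_vecMulVec, hc]
    ext i j
    simp [Matrix.vecMulVec_apply]
    ring
  have hs : CFC.sqrt ((c : ℂ) • ketbra v) = ((√c : ℝ) : ℂ) • ketbra v := by
    refine CFC.sqrt_unique ?_ (Matrix.nonneg_iff_posSemidef.2 (hP0.smul ?_))
    · rw [Matrix.smul_mul, Matrix.mul_smul, hPP, smul_smul, ← Complex.ofReal_mul,
        Real.mul_self_sqrt hc0]
    · exact Complex.zero_le_real.2 (Real.sqrt_nonneg c)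
  have htr : (ketbra v).trace = 1 := by
    rw [ketbra, Matrix.trace_vecMulVec, dotProduct_comm, hvv]
  rw [fidelity, hP, hPσ, hs, Matrix.trace_smul, htr, smul_eq_mul, mul_one, Complex.ofReal_re,
    Real.sq_sqrt hc0]

/-! ### Schmidt bounds versus the spectrum of the reduced state -/

section reduced

variable {A B : Type} [Fintype A] [DecidableEq A] [Fintype B] (φ : PureState A B)

theorem PureState.exists_unitary_diagonal : ∃ U : Matrix A A ℂ, U * Uᴴ = 1 ∧ Uᴴ * U = 1 ∧
    (Uᴴ * coeffMatrix φ.vec) * (Uᴴ * coeffMatrix φ.vec)ᴴ =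
      Matrix.diagonal fun i => (φ.reduced.eig i : ℂ) := by
  obtain ⟨U, hU, hU', hd⟩ := φ.reduced.exists_unitary
  refine ⟨U, hU, hU', ?_⟩
  rw [← hd, show φ.reduced.mat = _ from trRight_ketbra_eq φ.vec]
  simp only [Matrix.conjTranspose_mul, Matrix.conjTranspose_conjTranspose, Matrix.mul_assoc]

theorem PureState.suppCard_le {r : ℕ} (h : SchmidtRankLE r φ.vec) : φ.reduced.suppCard ≤ r := by
  obtain ⟨K, iK, f, g, hK, hφ⟩ := h
  have hM : coeffMatrix φ.vec = (Matrix.of fun a k => f k a) * Matrix.of g := by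
    ext a b
    simp [coeffMatrix, hφ, Matrix.mul_apply]
  have hr := φ.reduced.posSemidef.isHermitian.rank_eq_card_non_zero_eigs
  rw [Fintype.card_subtype] at hr
  change _ = φ.reduced.suppCard at hr
  rw [← hr, show φ.reduced.mat = _ from trRight_ketbra_eq φ.vec, hM, Matrix.mul_assoc]
  exact (Matrix.rank_mul_le_left _ _).trans ((Matrix.rank_le_card_width _).trans hK)

theorem PureState.maxEig_le {l : ℝ} (hl : 0 < l) (h : SchmidtCoeffLE l φ.vec) :
    φ.reduced.maxEig ≤ l := by
  obtain ⟨U, hU, hU', hd⟩ := φ.exists_unitary_diagonal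
  refine Finset.sup'_le _ _ fun i _ => ?_
  set z : B → ℂ := fun b => (Uᴴ * coeffMatrix φ.vec) i b with hz
  have hs : ∑ b, ‖z b‖ ^ 2 = φ.reduced.eig i := rowSq_of_diagonal _ _ hd i
  -- On this left Schmidt vector and its unnormalised partner the form equals the eigenvalue, which
  -- is also the squared norm of the partner; hence `eig ^ 2 ≤ l * eig`.
  have h' := h (fun a => star (U a i)) fun b => star (z b)
  have e : ∑ a, ∑ b, star (U a i) * star (z b) * φ.vec (a, b) = (φ.reduced.eig i : ℂ) := by
    rw [← hs, Complex.ofReal_sum, Finset.sum_comm]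
    refine Finset.sum_congr rfl fun b _ => ?_
    have hzb : z b = ∑ a, star (U a i) * φ.vec (a, b) := by
      simp [hz, Matrix.mul_apply, coeffMatrix]
    have : ((‖z b‖ ^ 2 : ℝ) : ℂ) = z b * star (z b) := by
      rw [← Complex.normSq_eq_norm_sq, ← Complex.mul_conj]
      rfl
    rw [this]
    refine Eq.trans ?_ (congrArg (· * star (z b)) hzb).symm
    simp only [Finset.sum_mul]
    exact Finset.sum_congr rfl fun a _ => by ring
  rw [e] at h'
  simp only [norm_star, colSq_of_conjTranspose_mul_eq_one U hU', hs, mul_one,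
    Complex.norm_real, Real.norm_eq_abs, sq_abs] at h'
  rcases (φ.reduced.eig_nonneg i).eq_or_lt with h0 | h0
  · rw [← h0]
    exact hl.le
  · exact le_of_mul_le_mul_right (by rwa [sq] at h') h0

/-- The Schmidt decomposition: rows of `Uᴴ * coeffMatrix φ.vec` belonging to eigenvalue zero vanish.
-/
theorem PureState.schmidtRankLE : SchmidtRankLE φ.reduced.suppCard φ.vec := by
  obtain ⟨U, hU, hU', hd⟩ := φ.exists_unitary_diagonal
  refine ⟨{i // φ.reduced.eig i ≠ 0}, inferInstance, fun i a => U a i,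
    fun i b => (Uᴴ * coeffMatrix φ.vec) i b, ?_, fun a b => ?_⟩
  · rw [Fintype.card_subtype]
    rfl
  · have hM : coeffMatrix φ.vec = U * (Uᴴ * coeffMatrix φ.vec) := by
      rw [← Matrix.mul_assoc, hU, Matrix.one_mul]
    have hab : φ.vec (a, b) = ∑ i, U a i * (Uᴴ * coeffMatrix φ.vec) i b := by
      change coeffMatrix φ.vec a b = _
      rw [← Matrix.mul_apply, ← hM]
    rw [hab]
    rw [← Finset.sum_subtype (Finset.univ.filter fun i => φ.reduced.eig i ≠ 0) (by simp)
      fun i => U a i * (Uᴴ * coeffMatrix φ.vec) i b]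
    symm
    refine Finset.sum_subset (Finset.subset_univ _) fun i _ hi => ?_
    have h0 : φ.reduced.eig i = 0 := by simpa using hi
    have hs := rowSq_of_diagonal _ _ hd i
    rw [h0, rowSq, Finset.sum_eq_zero_iff_of_nonneg fun _ _ => sq_nonneg _] at hs
    rw [norm_eq_zero.1 (pow_eq_zero_iff two_ne_zero |>.1 (hs b (Finset.mem_univ b))), mul_zero]

theorem PureState.schmidtCoeffLE : SchmidtCoeffLE φ.reduced.maxEig φ.vec := by
  obtain ⟨U, hU, hU', hd⟩ := φ.exists_unitary_diagonal
  intro x y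
  set V : Matrix Unit A ℂ := Matrix.of fun _ a => x a with hV
  have e : ∑ a, ∑ b, x a * y b * φ.vec (a, b) =
      ∑ b, (V * U * (Uᴴ * coeffMatrix φ.vec)) () b * y b := by
    rw [Finset.sum_comm, Matrix.mul_assoc, ← Matrix.mul_assoc U, hU, Matrix.one_mul]
    refine Finset.sum_congr rfl fun b _ => ?_
    simp only [hV, Matrix.mul_apply, coeffMatrix, Matrix.of_apply, Finset.sum_mul]
    exact Finset.sum_congr rfl fun a _ => by ring
  rw [e]
  refine (norm_sum_mul_sq_le _ _).trans (mul_le_mul_of_nonneg_right ?_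
    (Finset.sum_nonneg fun _ _ => sq_nonneg _))
  have h1 := rowSq_mul_of_diagonal (V * U) _ _ hd ()
  have h2 := rowSq_mul_of_diagonal V U (fun _ => 1) (by simpa using hU) ()
  simp only [one_mul] at h2
  change rowSq (V * U * (Uᴴ * coeffMatrix φ.vec)) () ≤ _
  rw [h1]
  refine (Finset.sum_le_sum fun i _ => mul_le_mul_of_nonneg_right
    (φ.reduced.eig_le_maxEig i) (sq_nonneg _)).trans_eq ?_
  rw [← Finset.mul_sum]
  exact congrArg _ h2

theorem PureState.hasSpread : HasSpread φ.reduced.suppCard φ.reduced.maxEig φ.vec :=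
  ⟨φ.normalized, φ.schmidtRankLE, φ.schmidtCoeffLE, φ.reduced.suppCard_pos,
    φ.reduced.maxEig_pos⟩

end reduced

/-! ### Supplementary EPR pairs -/

theorem prod_epr_eq (k : ℕ) (s t : Fin k → Fin 2) :
    ∏ i, epr (s i, t i) = if s = t then ((1 / √2 : ℝ) : ℂ) ^ k else 0 := by
  split_ifs with h
  · subst h
    simp [epr]
  · obtain ⟨i, hi⟩ := Function.ne_iff.1 h
    exact Finset.prod_eq_zero (Finset.mem_univ i) (by simp [epr, hi])

theorem norm_epr_pow_sq (k : ℕ) : ‖((1 / √2 : ℝ) : ℂ) ^ k‖ ^ 2 = ((2 : ℝ) ^ k)⁻¹ := by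
  rw [norm_pow, Complex.norm_real, Real.norm_eq_abs, ← pow_mul, mul_comm k 2, pow_mul, sq_abs,
    div_pow, Real.sq_sqrt zero_le_two, one_pow, one_div, inv_pow]

theorem HasSpread.withEPR {A B : Type} [Fintype A] [Fintype B] {r : ℕ} {l : ℝ} {φ : A × B → ℂ}
    (h : HasSpread r l φ) (k : ℕ) : HasSpread (r * 2 ^ k) (l / 2 ^ k) (withEPR φ k) := by
  classical
  refine ⟨?_, ?_, ?_, Nat.mul_pos h.rank_pos (by positivity), div_pos h.coeff_pos (by positivity)⟩
  · have hterm : ∀ a s b, ∑ t, ‖EntTransform.withEPR φ k ((a, s), (b, t))‖ ^ 2 =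
        ‖φ (a, b)‖ ^ 2 * ((2 : ℝ) ^ k)⁻¹ := by
      intro a s b
      rw [Finset.sum_eq_single s]
      · simp only [EntTransform.withEPR, prod_epr_eq, if_true, norm_mul, mul_pow, norm_epr_pow_sq]
      · intro t _ hts
        simp [EntTransform.withEPR, prod_epr_eq, Ne.symm hts]
      · simp
    have h1 := h.norm_eq
    rw [Fintype.sum_prod_type] at h1
    simp only [Fintype.sum_prod_type, hterm, Finset.sum_const, Finset.card_univ, nsmul_eq_mul,
      ← Finset.sum_mul, ← Finset.mul_sum]
    rw [h1]
    simp
  · obtain ⟨K, iK, f, g, hK, hfg⟩ := h.rank_le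
    refine ⟨K × (Fin k → Fin 2), inferInstance,
      fun x p => if p.2 = x.2 then f x.1 p.1 else 0,
      fun x p => g x.1 p.1 * ∏ i, epr (x.2 i, p.2 i), ?_, ?_⟩
    · rw [Fintype.card_prod]
      exact (Nat.mul_le_mul_right _ hK).trans_eq (by simp)
    · rintro ⟨a, s⟩ ⟨b, t⟩
      rw [Fintype.sum_prod_type]
      simp only [EntTransform.withEPR, hfg, ite_mul, zero_mul, Finset.sum_ite_eq,
        Finset.mem_univ, if_true, Finset.sum_mul]
      exact Finset.sum_congr rfl fun _ _ => by ring
  · intro x y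
    have e : ∑ p, ∑ p', x p * y p' * EntTransform.withEPR φ k (p, p') =
        ((1 / √2 : ℝ) : ℂ) ^ k * ∑ s, ∑ a, ∑ b, x (a, s) * y (b, s) * φ (a, b) := by
      rw [Fintype.sum_prod_type, Finset.sum_comm, Finset.mul_sum]
      refine Finset.sum_congr rfl fun s _ => ?_
      rw [Finset.mul_sum]
      refine Finset.sum_congr rfl fun a _ => ?_
      rw [Fintype.sum_prod_type, Finset.mul_sum]
      refine Finset.sum_congr rfl fun b _ => ?_
      rw [Finset.sum_eq_single s]
      · simp only [EntTransform.withEPR, prod_epr_eq, if_true]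
        ring
      · intro t _ hts
        simp [EntTransform.withEPR, prod_epr_eq, Ne.symm hts]
      · simp
    have hq := fun s => h.coeff_le (fun a => x (a, s)) fun b => y (b, s)
    have hl := h.coeff_pos.le
    -- Here both `x` and `y` split along `s`, so Cauchy–Schwarz loses no factor, and the EPR
    -- amplitude supplies the full `1 / 2 ^ k`.
    have h2 : ‖∑ s, ∑ a, ∑ b, x (a, s) * y (b, s) * φ (a, b)‖ ^ 2 ≤
        (∑ s, l * ∑ a, ‖x (a, s)‖ ^ 2) * ∑ s, ∑ b, ‖y (b, s)‖ ^ 2 :=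
      (pow_le_pow_left₀ (norm_nonneg _) (norm_sum_le _ _) 2).trans
        (Finset.sum_sq_le_sum_mul_sum_of_sq_le_mul Finset.univ
          (fun _ _ => mul_nonneg hl (Finset.sum_nonneg fun _ _ => sq_nonneg _))
          (fun _ _ => Finset.sum_nonneg fun _ _ => sq_nonneg _) fun s _ => hq s)
    rw [e, norm_mul, mul_pow, norm_epr_pow_sq, Fintype.sum_prod_type_right,
      Fintype.sum_prod_type_right]
    refine (mul_le_mul_of_nonneg_left h2 (by positivity)).trans_eq ?_
    rw [← Finset.mul_sum]
    ring

/-! ### Uhlmann's theorem and assembly of the lower bound -/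

/-- Uhlmann's theorem for a pure target state, in the form of an overlap with a product state. -/
theorem exists_pureState_overlap_eq {S T A B : Type} [Fintype S] [DecidableEq S] [Fintype T]
    [DecidableEq T] [Fintype A] [Fintype B] (ψ : PureState S T)
    (Φ : (S × A) × (T × B) → ℂ)
    (hpos : 0 < fidelity (ketbra ψ.vec) (trRight (ketbra fun p : (S × T) × (A × B) =>
      Φ ((p.1.1, p.2.1), (p.1.2, p.2.2))))) :
    ∃ χ : PureState A B, fidelity (ketbra ψ.vec) (trRight (ketbra
      fun p : (S × T) × (A × B) => Φ ((p.1.1, p.2.1), (p.1.2, p.2.2)))) =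
        ‖((coeffMatrix Φ)ᴴ * (coeffMatrix ψ.vec ⊗ₖ coeffMatrix χ.vec)).trace‖ ^ 2 := by
  set Φ' : (S × T) × (A × B) → ℂ := fun p => Φ ((p.1.1, p.2.1), (p.1.2, p.2.2)) with hΦ'
  -- `z` is the partial inner product of `ψ` with `Φ'`. Its squared norm is the fidelity, and `χ` is
  -- `z` normalised, which is why the fidelity must be positive.
  set z : A × B → ℂ := fun x => ∑ y, star (ψ.vec y) * Φ' (y, x) with hz
  set c := ∑ x, ‖z x‖ ^ 2 with hc
  have hc0 : 0 ≤ c := Finset.sum_nonneg fun _ _ => sq_nonneg _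
  have hcz : (c : ℂ) = ∑ x, z x * star (z x) := by
    rw [hc, Complex.ofReal_sum]
    refine Finset.sum_congr rfl fun x _ => ?_
    rw [← Complex.normSq_eq_norm_sq, ← Complex.mul_conj]
    rfl
  have hF : fidelity (ketbra ψ.vec) (trRight (ketbra Φ')) = c := by
    refine fidelity_ketbra ψ.vec ψ.normalized _ c hc0 ?_
    rw [hcz, trRight_ketbra_eq, ← Matrix.mulVec_mulVec, Matrix.dotProduct_mulVec]
    refine Finset.sum_congr rfl fun x _ => ?_
    have e1 : (star ψ.vec ᵥ* coeffMatrix Φ') x = z x := rfl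
    have e2 : ((coeffMatrix Φ')ᴴ *ᵥ ψ.vec) x = star (z x) := by
      simp only [hz, star_sum, star_mul', star_star, Matrix.mulVec, dotProduct,
        Matrix.conjTranspose_apply, coeffMatrix, Matrix.of_apply]
      exact Finset.sum_congr rfl fun _ _ => mul_comm _ _
    rw [e1, e2]
  rw [hF] at hpos ⊢
  have hs : 0 < √c := Real.sqrt_pos.2 hpos
  have hs2 : √c * √c = c := Real.mul_self_sqrt hc0
  refine ⟨⟨fun x => z x / (√c : ℂ), ?_⟩, ?_⟩
  · simp only [norm_div, div_pow, ← Finset.sum_div, Complex.norm_real, Real.norm_eq_abs, sq_abs]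
    rw [Real.sq_sqrt hc0, div_self hpos.ne']
  · have htr : ((coeffMatrix Φ)ᴴ * (coeffMatrix ψ.vec ⊗ₖ
        coeffMatrix fun x => z x / (√c : ℂ))).trace = (√c : ℂ) := by
      have e : ((coeffMatrix Φ)ᴴ * (coeffMatrix ψ.vec ⊗ₖ
          coeffMatrix fun x => z x / (√c : ℂ))).trace = ∑ x, z x / (√c : ℂ) * star (z x) := by
        have hzs : ∀ x, star (z x) = ∑ y : S × T, ψ.vec y * star (Φ' (y, x)) := fun x => by
          simp [hz]
        simp only [hzs, Finset.mul_sum]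
        rw [← Fintype.sum_prod_type' (f := fun (x : A × B) (y : S × T) =>
          z x / (√c : ℂ) * (ψ.vec y * star (Φ' (y, x))))]
        simp only [Matrix.trace, Matrix.diag_apply, Matrix.mul_apply, Matrix.conjTranspose_apply]
        rw [← Fintype.sum_prod_type' (f := fun (y : T × B) (x : S × A) =>
          star (coeffMatrix Φ x y) * (coeffMatrix ψ.vec ⊗ₖ
            coeffMatrix fun x => z x / (√c : ℂ)) x y)]
        refine Fintype.sum_equiv ⟨fun x => ((x.2.2, x.1.2), (x.2.1, x.1.1)),
          fun x => ((x.2.2, x.1.2), (x.2.1, x.1.1)), fun _ => rfl, fun _ => rfl⟩ _ _ fun x => ?_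
        simp only [Matrix.kroneckerMap_apply, coeffMatrix, Matrix.of_apply, hΦ', Equiv.coe_fn_mk]
        ring
      rw [e]
      simp only [div_mul_eq_mul_div, ← Finset.sum_div, ← hcz]
      rw [div_eq_iff (by exact_mod_cast hs.ne')]
      exact_mod_cast hs2.symm
    rw [htr, Complex.norm_real, Real.norm_eq_abs, sq_abs, Real.sq_sqrt hc0]

theorem Delta_le_add_two_mul_cost {A B S T : Type} [Fintype A] [DecidableEq A] [Fintype B]
    [DecidableEq B] [Fintype S] [DecidableEq S] [Fintype T] [DecidableEq T]
    (φ : PureState A B) (ψ : PureState S T) (ε δ : ℝ) (hδ0 : 0 ≤ δ) (hδ1 : δ < 1)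
    (hε : 4 * ε = δ ^ 8) (k : ℕ)
    (P : Protocol S T (A × (Fin k → Fin 2)) (B × (Fin k → Fin 2)))
    (hP : 1 - ε ≤ fidelity (ketbra ψ.vec) (P.output (withEPR φ.vec k))) :
    Delta δ ψ.reduced ≤ Delta 0 φ.reduced + 2 * P.cost - 2 * Real.logb 2 (1 - δ) := by
  obtain ⟨A', B', _, _, _, Φ, r, l, hΦ, ho, hcost⟩ :=
    P.exists_purification _ _ _ (φ.hasSpread.withEPR k)
  rw [ho] at hP
  have hε1 : ε < 1 := by nlinarith [pow_le_one₀ (n := 8) hδ0 hδ1.le]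
  obtain ⟨χ, hχ⟩ := exists_pureState_overlap_eq ψ Φ (lt_of_lt_of_le (by linarith) hP)
  rw [hχ] at hP
  set Ψ : PureState (S × A') (T × B') := ⟨Φ, hΦ.norm_eq⟩
  have h1 := Delta_le_of_overlap ψ χ Ψ ε δ hδ0 hδ1 hε hP
  have hsupp : (Ψ.reduced.suppCard : ℝ) ≤ r := by exact_mod_cast Ψ.suppCard_le hΦ.rank_le
  have hmax := Ψ.maxEig_le hΦ.coeff_pos hΦ.coeff_le
  have hs0 : (0 : ℝ) < Ψ.reduced.suppCard := by exact_mod_cast Ψ.reduced.suppCard_pos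
  have hm0 := Ψ.reduced.maxEig_pos
  have hδ' : 0 < 1 - δ := by linarith
  have h2 : Real.logb 2 (Ψ.reduced.suppCard * Ψ.reduced.maxEig) ≤ Real.logb 2 (r * l) :=
    Real.logb_le_logb_of_le one_lt_two (mul_pos hs0 hm0)
      (mul_le_mul hsupp hmax hm0.le (Nat.cast_nonneg r))
  -- The dependence on `k` cancels here.
  have h3 : ((φ.reduced.suppCard * 2 ^ k : ℕ) : ℝ) * (φ.reduced.maxEig / 2 ^ k) =
      φ.reduced.suppCard * φ.reduced.maxEig := by
    push_cast
    field_simp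
  rw [h3, ← DensityOperator.Delta_zero_eq] at hcost
  rw [Real.logb_div (mul_pos hs0 hm0).ne' (pow_pos hδ' 2).ne', Real.logb_pow] at h1
  push_cast at h1
  linarith

end EntTransform

theorem mainTheorem4 :
    -- a qubit in the maximally mixed state leaves `Δ_0` unchanged
    (∀ (n : Type) [Fintype n] [DecidableEq n] (ρ : EntTransform.DensityOperator n),
      EntTransform.Delta 0 (ρ.tensor EntTransform.mixedQubit) = EntTransform.Delta 0 ρ) ∧
    -- the lower bound, for initial states supplemented by any number `k` of EPR pairs
    (∀ (A B S T : Type) [Fintype A] [DecidableEq A] [Fintype B] [DecidableEq B]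
      [Fintype S] [DecidableEq S] [Fintype T] [DecidableEq T]
      (φ : EntTransform.PureState A B) (ψ : EntTransform.PureState S T)
      (ε δ : ℝ) (_ : 0 ≤ ε) (_ : δ = (4 * ε) ^ (1 / 8 : ℝ)) (_ : δ < 1)
      (k : ℕ) (P : EntTransform.Protocol S T (A × (Fin k → Fin 2)) (B × (Fin k → Fin 2)))
      (_ : 1 - ε ≤ EntTransform.fidelity (EntTransform.ketbra ψ.vec)
        (P.output (EntTransform.withEPR φ.vec k))),
      2 * P.cost ≥ EntTransform.Delta δ ψ.reduced - EntTransform.Delta 0 φ.reduced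
        + 2 * Real.logb 2 (1 - δ)) := by
  refine ⟨fun n _ _ ρ => EntTransform.Delta_zero_tensor_mixedQubit ρ, ?_⟩
  intro A B S T _ _ _ _ _ _ _ _ φ ψ ε δ hε hδ hδ1 k P hP
  have hδ0 : 0 ≤ δ := hδ ▸ Real.rpow_nonneg (by linarith) _
  have hδ8 : 4 * ε = δ ^ 8 := by
    rw [hδ, ← Real.rpow_natCast, ← Real.rpow_mul (by linarith)]
    norm_num
  have h := EntTransform.Delta_le_add_two_mul_cost φ ψ ε δ hδ0 hδ1 hδ8 k P hP
  linarith
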